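/- **Conventions (computability logic).** The players are the machine $\top$ and the environment $\bot$. A *move* is a finite string over the keyboard alphabet; a *run* is a finite or infinite sequence of moves labelled by the players who made them; a *position* is a finite run. A *constant game* $A$ is given by a set of legal positions that contains the empty one and is closed under initial segments (a run is legal iff all its finite initial segments are), and by a winner for every run, where the player who makes the first illegal move loses. Constants are the natural numbers, written in decimal; a *valuation* $e$ maps variables to constants; a *game* is a function from valuations to constant games. An *elementary* game has no legal moves and is won by $\top$ at $e$ iff a given predicate of $e$ holds. The operations on games are as follows. * $\neg A$ interchanges the players. * In $A\wedge B$ and $A\vee B$ both components are played in parallel (moves $1.\beta$ and $2.\beta$), and $\top$ must win both, respectively at least one, of them; $A\to B$ is $\neg A\vee B$. * In $\sqcap xA(x)$ (respectively $\sqcup xA(x)$) the first move is the choice of a constant $c$ by $\bot$ (respectively $\top$), after which $A(c)$ is played; if no choice is made, $\top$ (respectively $\bot$) wins. * Branching recurrences. An *actual node* of a position $\Phi$ is a bit string that is empty or of the form $u0$ or $u1$ where $\Phi$ contains the move "$u$:"; a *leaf* is an actual node that is not a proper prefix of another actual node. For an infinite bit string $x$, $\Theta^{\preceq x}$ is obtained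 from the run $\Theta$ by keeping only the moves of the form $u.\beta$ with $u$ an initial segment of $x$ and replacing each of them by $\beta$. The legal moves in a position $\Phi$, both of the uncountable branching recurrence $⫯A$ and of the countable branching recurrence $⫯^{\aleph_0}A$, are: "$w$:" by $\bot$, where $w$ is a leaf of $\Phi$; and $w.\alpha$ by either player $\wp$, where $w$ is an actual node of $\Phi$ and, for every infinite bit string $v$, $\alpha$ is a legal move by $\wp$ in the position $\Phi^{\preceq wv}$ of $A$. A legal run $\Gamma$ is won by $\top$ in $⫯A$ iff $\Gamma^{\preceq v}$ is won by $\top$ in $A$ for every infinite bit string $v$; in $⫯^{\aleph_0}A$ this is required only for those $v$ that contain finitely many $1$s. A *hard-play machine* (HPM) is a deterministic Turing machine with a work tape, a read-only tape spelling the valuation, and a read-only run tape spelling the current position. In each computation step it may make at most one move, while the environment may make any finite number of arbitrary moves; all these moves are appended to the run tape. An HPM *computes* a game $A$ iff, for every valuation $e$, every run that it can generate on $e$, against any behaviour of the environment, is won by $\top$ in $A$ at $e$. An *interpretation* sends each $n$-ary elementary letter to an elementary game with an attached tuple of $n$ distinct variables; it is *admissible* for a formula $F$ iff the game assigned to any letter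 of $F$ does not depend on variables that occur in $F$ but are not in the attached tuple. A formula $F$ is *uniformly valid* iff there is a single HPM that computes $F^*$ for every interpretation $^*$ admissible for $F$. **Theorem.** Let $p$ be a binary elementary letter and let $x,y$ be distinct variables. Both for $!=⫯$ and for $!=⫯^{\aleph_0}$, the instance $$\sqcup x\sqcap y\,p(x,y)\ \wedge\ !\Bigl(\sqcup x\sqcap y\,p(x,y)\to\bigl(\sqcup x\sqcap y\,p(x,y)\wedge\sqcup x\sqcap y\,p(x,y)\bigr)\Bigr)\ \to\ !\,\sqcup x\sqcap y\,p(x,y)$$ of the short production principle $P\wedge\,!(P\to P\wedge P)\to\,!P$ is not uniformly valid. -/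

import Mathlib

namespace CoL

/-! ### Players, moves, positions, runs -/

/-- The two players: the machine `⊤` and the environment `⊥`. -/
inductive Player : Type
  | machine : Player
  | environment : Player

/-- The adversary of a player. -/
def Player.other : Player → Player
  | Player.machine => Player.environment
  | Player.environment => Player.machine

/-- The keyboard alphabet: the ten decimal digits, the period, the colon, and the remaining
printable characters. -/
inductive Key : Type
  | digit (d : Fin 10) : Key
  | dot : Key
  | colon : Key
  | misc (n : Fin 83) : Key
  deriving DecidableEq

/-- A move is a finite string over the keyboard alphabet. -/
abbrev Move : Type := List Key

/-- A labmove is a move together with the player who made it. -/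
abbrev LabMove : Type := Player × Move

/-- A position is a finite sequence of labmoves. -/
abbrev Position : Type := List LabMove

/-- A run is a finite or infinite sequence of labmoves. It is represented by the set of all of
its finite initial segments: a nonempty set of positions that is closed under initial segments
and linearly ordered by the initial segment relation. -/
structure Run : Type where
  /-- the finite initial segments of the run -/
  positions : Set Position
  nil_mem : [] ∈ positions
  prefix_mem : ∀ {Φ Ψ : Position}, Φ <+: Ψ → Ψ ∈ positions → Φ ∈ positions
  chain : ∀ {Φ Ψ : Position}, Φ ∈ positions → Ψ ∈ positions → Φ <+: Ψ ∨ Ψ <+: Φ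

theorem prefix_filterMap {α β : Type} (f : α → Option β) :
    ∀ (l : List α) (m : List β), m <+: l.filterMap f → ∃ l', l' <+: l ∧ l'.filterMap f = m := by
  intro l
  induction l with
  | nil =>
    intro m hm
    exact ⟨[], List.prefix_rfl, by simpa [eq_comm] using hm⟩
  | cons a l ih =>
    intro m hm
    cases hfa : f a with
    | none =>
      rw [List.filterMap_cons_none hfa] at hm
      obtain ⟨l', h1, h2⟩ := ih m hm
      exact ⟨a :: l', by simpa using h1, by rw [List.filterMap_cons_none hfa, h2]⟩
    | some b =>
      rw [List.filterMap_cons_some hfa] at hm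
      cases m with
      | nil => exact ⟨[], List.nil_prefix, rfl⟩
      | cons c m =>
        rw [List.cons_prefix_cons] at hm
        obtain ⟨l', h1, h2⟩ := ih m hm.2
        exact ⟨a :: l', by simpa using h1, by rw [List.filterMap_cons_some hfa, h2, hm.1]⟩

/-- Apply `f` to the successive labmoves of a run, deleting those on which `f` is undefined. -/
def Run.filterMap (f : LabMove → Option LabMove) (Γ : Run) : Run where
  positions := (fun Φ : Position => Φ.filterMap f) '' Γ.positions
  nil_mem := ⟨[], Γ.nil_mem, rfl⟩
  prefix_mem := by
    rintro Φ _ h ⟨Ψ, hΨ, rfl⟩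
    obtain ⟨Ψ', h1, h2⟩ := prefix_filterMap f Ψ Φ h
    exact ⟨Ψ', Γ.prefix_mem h1 hΨ, h2⟩
  chain := by
    rintro _ _ ⟨Φ, hΦ, rfl⟩ ⟨Ψ, hΨ, rfl⟩
    exact (Γ.chain hΦ hΨ).imp (fun h => h.filterMap f) (fun h => h.filterMap f)

/-- Reversal of the label of a labmove. -/
def LabMove.neg (l : LabMove) : LabMove := (l.1.other, l.2)

/-- The negation of a run: all labels are reversed. -/
def Run.neg (Γ : Run) : Run := Γ.filterMap fun l => some (LabMove.neg l)

theorem prefix_tail {α : Type} {l m : List α} (h : l <+: m) : l.tail <+: m.tail := by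
  obtain ⟨t, rfl⟩ := h
  cases l with
  | nil => exact List.nil_prefix
  | cons a l => exact List.prefix_append _ _

/-- The run without its first labmove. -/
def Run.tail (Γ : Run) : Run where
  positions := List.tail '' Γ.positions
  nil_mem := ⟨[], Γ.nil_mem, rfl⟩
  prefix_mem := by
    rintro Φ _ h ⟨Ψ, hΨ, rfl⟩
    cases Ψ with
    | nil => exact ⟨[], Γ.nil_mem, by simpa [eq_comm] using h⟩
    | cons a Ψ =>
      exact ⟨a :: Φ, Γ.prefix_mem (by simpa using h) hΨ, rfl⟩
  chain := by
    rintro _ _ ⟨Φ, hΦ, rfl⟩ ⟨Ψ, hΨ, rfl⟩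
    exact (Γ.chain hΦ hΨ).imp prefix_tail prefix_tail

/-! ### Constant games -/

/-- Given a set of legal positions, the run `Γ` is `℘`-illegal: it is illegal, and the last
labmove of its shortest illegal initial segment is by `℘`. -/
def IllegalBy (legal : Set Position) (p : Player) (Γ : Run) : Prop :=
  ∃ (Φ : Position) (α : Move),
    Φ ++ [(p, α)] ∈ Γ.positions ∧ Φ ∈ legal ∧ Φ ++ [(p, α)] ∉ legal

/-- A constant game: its legal positions (a run is legal iff all of its finite initial segments
are) and the winner of every run, where a player who makes the first illegal move loses. -/
structure ConstGame : Type where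
  legal : Set Position
  nil_legal : [] ∈ legal
  prefix_legal : ∀ {Φ Ψ : Position}, Φ <+: Ψ → Ψ ∈ legal → Φ ∈ legal
  Wn : Run → Player
  wn_illegal : ∀ (p : Player) (Γ : Run), IllegalBy legal p Γ → Wn Γ = p.other

/-- A run is legal iff all of its finite initial segments are. -/
def LegalRun (legal : Set Position) (Γ : Run) : Prop := Γ.positions ⊆ legal

open Classical in
/-- The winner of a run, when `win` says which legal runs are won by the machine: an illegal
run is lost by the player who made the first illegal move. -/
noncomputable def winner (legal : Set Position) (win : Run → Prop) (Γ : Run) : Player :=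
  if (LegalRun legal Γ ∧ win Γ) ∨ IllegalBy legal Player.environment Γ then Player.machine
  else Player.environment

/-- The constant game with the given legal positions in which a legal run `Γ` is won by the
machine iff `win Γ`. -/
noncomputable def ConstGame.ofLegal (legal : Set Position) (nil_legal : [] ∈ legal)
    (prefix_legal : ∀ {Φ Ψ : Position}, Φ <+: Ψ → Ψ ∈ legal → Φ ∈ legal)
    (win : Run → Prop) : ConstGame where
  legal := legal
  nil_legal := nil_legal
  prefix_legal := prefix_legal
  Wn := winner legal win
  wn_illegal := by
    intro p Γ h
    cases p with
    | environment =>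
      unfold winner
      rw [if_pos (Or.inr h)]
      rfl
    | machine =>
      unfold winner
      rw [if_neg]
      · rfl
      · obtain ⟨Φ, α, h1, h2, h3⟩ := h
        rintro (⟨h4, -⟩ | ⟨Ψ, β, h4, h5, h6⟩)
        · exact h3 (h4 h1)
        · rcases Γ.chain h1 h4 with h7 | h7
          · rcases List.prefix_concat_iff.1 h7 with h8 | h8
            · simp at h8
            · exact h3 (prefix_legal h8 h5)
          · rcases List.prefix_concat_iff.1 h7 with h8 | h8
            · simp at h8
            · exact h6 (prefix_legal h8 h2)

/-! ### Operations on constant games -/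

/-- The elementary game (no legal moves) won by the machine iff `P` holds. -/
noncomputable def ConstGame.elementary (P : Prop) : ConstGame :=
  ConstGame.ofLegal {Φ | Φ = []} rfl
    (by rintro Φ Ψ h rfl; simpa using h) (fun _ => P)

/-- Negation: the players switch roles. -/
noncomputable def ConstGame.neg (A : ConstGame) : ConstGame :=
  ConstGame.ofLegal {Φ | Φ.map LabMove.neg ∈ A.legal} A.nil_legal
    (fun h hΨ => A.prefix_legal (h.map LabMove.neg) hΨ)
    (fun Γ => A.Wn Γ.neg = Player.environment)

/-- If the move is `i.β`, where `i` is a single digit, return `β`. -/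
def stripComponent (i : Fin 10) : Move → Option Move
  | k :: l :: β => if k = Key.digit i ∧ l = Key.dot then some β else none
  | _ => none

/-- The labmove played in the `i`th component, if there is one. -/
def inComponent (i : Fin 10) (l : LabMove) : Option LabMove :=
  (stripComponent i l.2).map fun β => (l.1, β)

/-- The legal positions of a parallel combination of `A` and `B`: every move is `1.β` or `2.β`,
the moves `1.β` form a legal position of `A`, and the moves `2.β` one of `B`. -/
def parLegal (A B : ConstGame) : Set Position :=
  {Φ | (∀ l ∈ Φ, (inComponent 1 l).isSome ∨ (inComponent 2 l).isSome) ∧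
    Φ.filterMap (inComponent 1) ∈ A.legal ∧ Φ.filterMap (inComponent 2) ∈ B.legal}

theorem parLegal_prefix (A B : ConstGame) {Φ Ψ : Position} (h : Φ <+: Ψ)
    (hΨ : Ψ ∈ parLegal A B) : Φ ∈ parLegal A B :=
  ⟨fun l hl => hΨ.1 l (h.subset hl), A.prefix_legal (h.filterMap _) hΨ.2.1,
    B.prefix_legal (h.filterMap _) hΨ.2.2⟩

theorem parLegal_nil (A B : ConstGame) : [] ∈ parLegal A B :=
  ⟨by simp, A.nil_legal, B.nil_legal⟩

/-- Parallel conjunction: the machine has to win both components. -/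
noncomputable def ConstGame.pand (A B : ConstGame) : ConstGame :=
  ConstGame.ofLegal (parLegal A B) (parLegal_nil A B) (parLegal_prefix A B)
    (fun Γ => A.Wn (Γ.filterMap (inComponent 1)) = Player.machine ∧
      B.Wn (Γ.filterMap (inComponent 2)) = Player.machine)

/-- Parallel disjunction: the machine has to win at least one component. -/
noncomputable def ConstGame.por (A B : ConstGame) : ConstGame :=
  ConstGame.ofLegal (parLegal A B) (parLegal_nil A B) (parLegal_prefix A B)
    (fun Γ => A.Wn (Γ.filterMap (inComponent 1)) = Player.machine ∨
      B.Wn (Γ.filterMap (inComponent 2)) = Player.machine)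

/-- The decimal numeral of a natural number. The constants are the decimal numerals, which are
identified with the natural numbers. -/
def numeral (n : ℕ) : Move :=
  if n = 0 then [Key.digit 0] else (Nat.digits 10 n).reverse.map fun d => Key.digit (Fin.ofNat 10 d)

/-- The legal positions of a choice by the player `p` of one of the games `A 0, A 1, …`: either
nothing has been played yet, or the first move is the choice by `p` of a constant `c`, and the
rest is a legal position of `A c`. -/
def choiceLegal (p : Player) (A : ℕ → ConstGame) : Set Position :=
  {Φ | Φ = [] ∨ ∃ (c : ℕ) (Δ : Position), Φ = (p, numeral c) :: Δ ∧ Δ ∈ (A c).legal}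

theorem choiceLegal_prefix (p : Player) (A : ℕ → ConstGame) {Φ Ψ : Position} (h : Φ <+: Ψ)
    (hΨ : Ψ ∈ choiceLegal p A) : Φ ∈ choiceLegal p A := by
  rcases hΨ with rfl | ⟨c, Δ, rfl, hΔ⟩
  · exact Or.inl (by simpa using h)
  · cases Φ with
    | nil => exact Or.inl rfl
    | cons a Φ =>
      rw [List.cons_prefix_cons] at h
      exact Or.inr ⟨c, Φ, by rw [h.1], (A c).prefix_legal h.2 hΔ⟩

/-- Choice conjunction of `A 0, A 1, …`: the environment chooses; the machine wins if no choice
is made. -/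
noncomputable def ConstGame.chooseAll (A : ℕ → ConstGame) : ConstGame :=
  ConstGame.ofLegal (choiceLegal Player.environment A) (Or.inl rfl)
    (choiceLegal_prefix Player.environment A)
    (fun Γ => ∀ c : ℕ, [(Player.environment, numeral c)] ∈ Γ.positions →
      (A c).Wn Γ.tail = Player.machine)

/-- Choice disjunction of `A 0, A 1, …`: the machine chooses; the environment wins if no choice
is made. -/
noncomputable def ConstGame.chooseEx (A : ℕ → ConstGame) : ConstGame :=
  ConstGame.ofLegal (choiceLegal Player.machine A) (Or.inl rfl)
    (choiceLegal_prefix Player.machine A)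
    (fun Γ => ∃ c : ℕ, [(Player.machine, numeral c)] ∈ Γ.positions ∧
      (A c).Wn Γ.tail = Player.machine)

/-! ### Branching recurrences -/

/-- A bit, as a keyboard character. -/
def bitKey (b : Bool) : Key := if b then Key.digit 1 else Key.digit 0

/-- The replicative move `w:`. -/
def replicative (w : List Bool) : Move := w.map bitKey ++ [Key.colon]

/-- The non-replicative move `w.α`. -/
def nonReplicative (w : List Bool) (α : Move) : Move := w.map bitKey ++ Key.dot :: α

/-- An actual node of `Φ`: the empty bit string, or `u0` or `u1` where `Φ` contains `u:`. -/
def ActualNode (Φ : Position) (w : List Bool) : Prop :=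
  w = [] ∨ ∃ (u : List Bool) (b : Bool) (p : Player), w = u ++ [b] ∧ (p, replicative u) ∈ Φ

/-- A leaf of `Φ`: an actual node that is not a proper prefix of any other actual node. -/
def IsLeaf (Φ : Position) (w : List Bool) : Prop :=
  ActualNode Φ w ∧ ∀ w' : List Bool, ActualNode Φ w' → w <+: w' → w' = w

/-- If the move is `u.β` for some initial segment `u` of the infinite bit string `x`,
return `β`. -/
def stripThread : (ℕ → Bool) → Move → Option Move
  | _, [] => none
  | x, k :: m =>
    if k = Key.dot then some m
    else if k = bitKey (x 0) then stripThread (fun n => x (n + 1)) m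
    else none

/-- The labmove as played in the thread `x`, if it concerns that thread. Deleting from `Θ` all
the other labmoves yields `Θ^{≼x}`. -/
def inThread (x : ℕ → Bool) (l : LabMove) : Option LabMove :=
  (stripThread x l.2).map fun β => (l.1, β)

/-- The infinite bit string `wv`. -/
def appendBits (w : List Bool) (v : ℕ → Bool) (n : ℕ) : Bool :=
  if h : n < w.length then w[n] else v (n - w.length)

/-- The legal labmoves in the position `Φ` of a branching recurrence of `A`. -/
def BranchLegalMove (A : ConstGame) (Φ : Position) (l : LabMove) : Prop :=
  (∃ w : List Bool, IsLeaf Φ w ∧ l = (Player.environment, replicative w)) ∨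
  (∃ (w : List Bool) (p : Player) (α : Move), ActualNode Φ w ∧ l = (p, nonReplicative w α) ∧
    ∀ v : ℕ → Bool, Φ.filterMap (inThread (appendBits w v)) ++ [(p, α)] ∈ A.legal)

/-- The legal positions of a branching recurrence of `A`: each labmove is legal in the position
that precedes it. -/
def branchLegal (A : ConstGame) : Set Position :=
  {Φ | ∀ (Ψ : Position) (l : LabMove), Ψ ++ [l] <+: Φ → BranchLegalMove A Ψ l}

/-- The two branching recurrences. -/
inductive Recurrence : Type
  | uncountable : Recurrence
  | countable : Recurrence

/-- The threads that matter for the winner: all infinite bit strings for the uncountable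
recurrence, and the essentially finite ones (finitely many 1s) for the countable one. -/
def Recurrence.Relevant : Recurrence → (ℕ → Bool) → Prop
  | Recurrence.uncountable, _ => True
  | Recurrence.countable, v => {n : ℕ | v n = true}.Finite

/-- (Un)countable branching recurrence: the machine has to win `A` in all relevant threads. -/
noncomputable def ConstGame.branch (r : Recurrence) (A : ConstGame) : ConstGame :=
  ConstGame.ofLegal (branchLegal A)
    (by intro Ψ l h; simp at h)
    (fun h hΨ Θ l hl => hΨ Θ l (hl.trans h))
    (fun Γ => ∀ v : ℕ → Bool, r.Relevant v → A.Wn (Γ.filterMap (inThread v)) = Player.machine)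

/-! ### Formulas and interpretations -/

/-- Variables. -/
abbrev Var : Type := ℕ

/-- A valuation assigns a constant to every variable. -/
abbrev Valuation : Type := Var → ℕ

/-- A game: a constant game for every valuation. -/
abbrev Game : Type := Valuation → ConstGame

/-- A term is a variable or a constant. -/
inductive Term : Type
  | var (x : Var) : Term
  | const (c : ℕ) : Term

/-- The value of a term under a valuation. -/
def Term.eval (e : Valuation) : Term → ℕ
  | Term.var x => e x
  | Term.const c => c

/-- The variables of a term. -/
def Term.vars : Term → Set Var
  | Term.var x => {x}
  | Term.const _ => ∅

/-- Formulas over elementary letters: `atom n i t` is the `i`th `n`-ary elementary letter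
applied to the terms `t`; `neg`, `pand`, `por` are `¬`, `∧`, `∨`; `chooseAll`, `chooseEx` are the
choice quantifiers `⊓`, `⊔`; `branch r` are the branching recurrences. -/
inductive Formula : Type
  | atom (n i : ℕ) (t : Fin n → Term) : Formula
  | neg (F : Formula) : Formula
  | pand (F G : Formula) : Formula
  | por (F G : Formula) : Formula
  | chooseAll (x : Var) (F : Formula) : Formula
  | chooseEx (x : Var) (F : Formula) : Formula
  | branch (r : Recurrence) (F : Formula) : Formula

/-- `F → G` abbreviates `¬F ∨ G`. -/
def Formula.imp (F G : Formula) : Formula := Formula.por (Formula.neg F) G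

/-- The variables that occur in a formula. -/
def Formula.vars : Formula → Set Var
  | Formula.atom _ _ t => ⋃ j, (t j).vars
  | Formula.neg F => F.vars
  | Formula.pand F G => F.vars ∪ G.vars
  | Formula.por F G => F.vars ∪ G.vars
  | Formula.chooseAll x F => insert x F.vars
  | Formula.chooseEx x F => insert x F.vars
  | Formula.branch _ F => F.vars

/-- The letters (arity, index) that occur in a formula. -/
def Formula.letters : Formula → Set (ℕ × ℕ)
  | Formula.atom n i _ => {(n, i)}
  | Formula.neg F => F.letters
  | Formula.pand F G => F.letters ∪ G.letters
  | Formula.por F G => F.letters ∪ G.letters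
  | Formula.chooseAll _ F => F.letters
  | Formula.chooseEx _ F => F.letters
  | Formula.branch _ F => F.letters

/-- An interpretation sends every `n`-ary elementary letter to an elementary game, given by the
set of valuations at which it is won by the machine, with an attached tuple of `n` distinct
variables. -/
structure Interpretation : Type where
  tuple : (n i : ℕ) → Fin n → Var
  tuple_injective : ∀ n i : ℕ, Function.Injective (tuple n i)
  holds : (n i : ℕ) → Valuation → Prop

/-- A predicate of valuations depends on the variable `z`. -/
def DependsOn (P : Valuation → Prop) (z : Var) : Prop :=
  ∃ e e' : Valuation, (∀ x : Var, x ≠ z → e x = e' x) ∧ ¬ (P e ↔ P e')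

/-- The interpretation is admissible for `F`: the game assigned to a letter of `F` does not
depend on any variable that occurs in `F` without being in the attached tuple. -/
def Interpretation.Admissible (I : Interpretation) (F : Formula) : Prop :=
  ∀ n i : ℕ, (n, i) ∈ F.letters → ∀ z ∈ F.vars, z ∉ Set.range (I.tuple n i) →
    ¬ DependsOn (I.holds n i) z

/-- The game into which an interpretation turns a formula. In an atom, the terms are
substituted for the variables of the attached tuple. -/
noncomputable def Formula.toGame (I : Interpretation) : Formula → Game
  | Formula.atom n i t => fun e =>
      ConstGame.elementary
        (I.holds n i (Function.extend (I.tuple n i) (fun j => (t j).eval e) e))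
  | Formula.neg F => fun e => (F.toGame I e).neg
  | Formula.pand F G => fun e => (F.toGame I e).pand (G.toGame I e)
  | Formula.por F G => fun e => (F.toGame I e).por (G.toGame I e)
  | Formula.chooseAll x F => fun e =>
      ConstGame.chooseAll fun c => F.toGame I (Function.update e x c)
  | Formula.chooseEx x F => fun e =>
      ConstGame.chooseEx fun c => F.toGame I (Function.update e x c)
  | Formula.branch r F => fun e => (F.toGame I e).branch r

/-! ### Hard-play machines -/

/-- Movements of a tape head. -/
inductive Dir : Type
  | left : Dir
  | stay : Dir
  | right : Dir

/-- Move a head on a one-way infinite tape. -/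
def Dir.apply : Dir → ℕ → ℕ
  | Dir.left, n => n - 1
  | Dir.stay, n => n
  | Dir.right, n => n + 1

/-- A hard-play machine: a deterministic Turing machine with a read/write work tape and two
read-only tapes, the valuation tape and the run tape. A work tape cell holds a keyboard
character, one of finitely many extra symbols, or the blank `none`; a valuation tape cell a
keyboard character or the separator `none`; a run tape cell a label, a keyboard character, or
the blank `none`. In one step the machine changes its state, rewrites the scanned cell of the
work tape, and moves the heads of the work, valuation and run tape. -/
structure HPM : Type 1 where
  State : Type
  finite_state : Finite State
  Extra : Type
  finite_extra : Finite Extra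
  start : State
  moveStates : Set State
  trans : State → Option (Key ⊕ Extra) → Option Key → Option (Player ⊕ Key) →
    State × Option (Key ⊕ Extra) × Dir × Dir × Dir

/-- The `i`th cell of the valuation tape, which spells the values of the variables one after
another, each followed by a separator. -/
def valuationTape (e : Valuation) (i : ℕ) : Option Key :=
  ((List.range (i + 1)).flatMap fun x => (numeral (e x)).map some ++ [none]).getD i none

/-- The `i`th cell of the run tape, which spells the labmoves of the current position. -/
def runTape (Φ : Position) (i : ℕ) : Option (Player ⊕ Key) :=
  (Φ.flatMap fun l => Sum.inl l.1 :: l.2.map Sum.inr)[i]?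

/-- A configuration of a hard-play machine. -/
structure HPM.Config (M : HPM) : Type where
  state : M.State
  work : ℕ → Option (Key ⊕ M.Extra)
  workHead : ℕ
  valHead : ℕ
  runHead : ℕ
  position : Position

/-- The initial configuration. -/
def HPM.init (M : HPM) : M.Config where
  state := M.start
  work := fun _ => none
  workHead := 0
  valHead := 0
  runHead := 0
  position := []

/-- One step of the machine on the valuation `e`, before the update of the run tape. -/
def HPM.next (M : HPM) (e : Valuation) (C : M.Config) : M.Config :=
  match M.trans C.state (C.work C.workHead) (valuationTape e C.valHead)
      (runTape C.position C.runHead) with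
  | (q, s, dw, dv, dr) =>
    { state := q
      work := Function.update C.work C.workHead s
      workHead := dw.apply C.workHead
      valHead := dv.apply C.valHead
      runHead := dr.apply C.runHead
      position := C.position }

/-- The keyboard string at the beginning of the work tape, to the left of the head. -/
def HPM.Config.buffer {M : HPM} (C : M.Config) : Move :=
  (((List.range C.workHead).map C.work).takeWhile fun s => (s.bind Sum.getLeft?).isSome).filterMap
    fun s => s.bind Sum.getLeft?

open Classical in
/-- The move made by the machine when it enters the configuration `C`: if the state is a move
state, the string in the buffer; otherwise none. -/
noncomputable def HPM.Config.moveMade {M : HPM} (C : M.Config) : Position :=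
  if C.state ∈ M.moveStates then [(Player.machine, C.buffer)] else []

/-- `C'` is a successor of `C`: the machine makes one step and thereby at most one move, the
environment makes finitely many arbitrary moves, and these moves are appended to the run tape,
the order between the two players being arbitrary. -/
def HPM.Succ (M : HPM) (e : Valuation) (C C' : M.Config) : Prop :=
  ∃ before after : List Move,
    C' = { M.next e C with
      position := C.position ++ before.map (fun α => (Player.environment, α)) ++
        (M.next e C).moveMade ++ after.map (fun α => (Player.environment, α)) }

/-- A computation branch of the machine on the valuation `e`. -/
structure HPM.Branch (M : HPM) (e : Valuation) : Type where
  config : ℕ → M.Config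
  config_zero : config 0 = M.init
  config_succ : ∀ k : ℕ, M.Succ e (config k) (config (k + 1))

theorem HPM.Branch.position_prefix {M : HPM} {e : Valuation} (B : M.Branch e) {i j : ℕ}
    (h : i ≤ j) : (B.config i).position <+: (B.config j).position := by
  induction h with
  | refl => exact List.prefix_rfl
  | step _ ih =>
    refine ih.trans ?_
    obtain ⟨before, after, hC⟩ := B.config_succ _
    rw [hC]
    simp only [List.append_assoc]
    exact List.prefix_append _ _

/-- The run spelled by a computation branch. -/
def HPM.Branch.run {M : HPM} {e : Valuation} (B : M.Branch e) : Run where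
  positions := {Φ | ∃ k : ℕ, Φ <+: (B.config k).position}
  nil_mem := ⟨0, List.nil_prefix⟩
  prefix_mem := by
    rintro Φ Ψ h ⟨k, hk⟩
    exact ⟨k, h.trans hk⟩
  chain := by
    rintro Φ Ψ ⟨i, hi⟩ ⟨j, hj⟩
    exact List.prefix_or_prefix_of_prefix
      (hi.trans (B.position_prefix (le_max_left i j)))
      (hj.trans (B.position_prefix (le_max_right i j)))

/-- The machine `M` computes (wins) the game `A`: on every valuation `e`, every run that `M` can
generate is won by the machine in the constant game `A e`. -/
def HPM.Computes (M : HPM) (A : Game) : Prop :=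
  ∀ (e : Valuation) (B : M.Branch e), (A e).Wn B.run = Player.machine

/-- Uniform validity: one and the same machine wins the game under all admissible
interpretations. -/
def UniformlyValid (F : Formula) : Prop :=
  ∃ M : HPM, ∀ I : Interpretation, I.Admissible F → M.Computes (F.toGame I)

/-! ### Short production -/

/-- The short production principle `P ∧ !(P → P ∧ P) → !P`. -/
def shortProduction (r : Recurrence) (P : Formula) : Formula :=
  Formula.imp
    (Formula.pand P (Formula.branch r (Formula.imp P (Formula.pand P P))))
    (Formula.branch r P)

/-- The formula `⊔x⊓y p(x, y)`, where `p` is the `i`th binary elementary letter. -/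
def choiceFormula (i : ℕ) (x y : Var) : Formula :=
  Formula.chooseEx x (Formula.chooseAll y (Formula.atom 2 i ![Term.var x, Term.var y]))

end CoL

/-!
Write `P` for `⊔x⊓y p(x, y)`. Against any machine, the environment plays as follows. When the
machine chooses `m` in the goal `!P`, the environment splits the goal and answers `0` in one copy
and `1` in the other. In the resource `P` it chooses `0`, and whenever the machine chooses `a` in
the antecedent of a thread of `!(P → P ∧ P)`, it chooses `2a + 1` and `2a + 2` in the two copies of
`P` in the consequent. These are the children of `a` in the infinite binary tree with root `0`. If
the machine answers a child that is an ancestor of `m`, the environment passes this answer on to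
`a`. All threads through a leaf agree, so its moves at the leaves serve all threads.

After the run, let `p(c, y)` say that, if `c` is an ancestor of `m`, then `y` is the answer of the
machine in the resource `P`. This makes the environment win its resources: the root is answered
correctly by definition, and each node has at most one child among the ancestors of `m`, so it can
inherit the answer of that child. As `m` is its own ancestor, the machine can win the goal only if
both `0` and `1` are its single answer in `P`. Legality does not depend on the interpretation, which
is why `p` may be chosen after the run.
-/

namespace CoL

/-! ### Replying with legal moves -/

section Replies

variable {p : Player} {Φ Ψ : Position} {I J : Set Position} {legal : Set Position}

theorem Player.other_other (p : Player) : p.other.other = p := by cases p <;> rfl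

/-- The position in which the player `p` has made the moves `L`, one after another. -/
def moves (p : Player) (L : List Move) : Position := L.map fun α => (p, α)

theorem moves_append (p : Player) (L L' : List Move) :
    moves p (L ++ L') = moves p L ++ moves p L' := List.map_append

/-- The player `p` can move from `Φ` into the set `I` before the adversary moves again. -/
def Reaches (p : Player) (Φ : Position) (I : Set Position) : Prop :=
  ∃ L : List Move, Φ ++ moves p L ∈ I

theorem Reaches.of_mem (h : Φ ∈ I) : Reaches p Φ I :=
  ⟨[], by rwa [moves, List.map_nil, List.append_nil]⟩

theorem Reaches.trans (hI : Reaches p Φ I) (hJ : ∀ Ψ ∈ I, Reaches p Ψ J) : Reaches p Φ J := by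
  obtain ⟨L, hL⟩ := hI
  obtain ⟨L', hL'⟩ := hJ _ hL
  exact ⟨L ++ L', by rwa [moves_append, ← List.append_assoc]⟩

theorem Reaches.mono (h : Reaches p Φ I) (hIJ : I ⊆ J) : Reaches p Φ J :=
  h.imp fun _ hL => hIJ hL

/-- `Ψ` results from `Φ` when the player `p` makes at most one move. -/
def PassOrMove (p : Player) (Φ Ψ : Position) : Prop :=
  Ψ = Φ ∨ ∃ α : Move, Ψ = Φ ++ [(p, α)]

theorem PassOrMove.prefix (h : PassOrMove p Φ Ψ) : Φ <+: Ψ := by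
  rcases h with rfl | ⟨α, rfl⟩
  · exact List.prefix_rfl
  · exact List.prefix_append _ _

/-- A nondeterministic strategy of the player `p`, given by the set `I` of the positions at which
it aims: after every pass or legal move of the adversary, `p` can move back into `I`. -/
def Maintains (legal : Set Position) (p : Player) (I : Set Position) : Prop :=
  ∀ Φ ∈ I, ∀ Ψ ∈ legal, PassOrMove p.other Φ Ψ → Reaches p Ψ I

/-- What remains of a position when every move `α` is replaced by `f α`, or deleted if `f α` is
undefined. The components and the threads of a position are obtained in this way. -/
def sift (f : Move → Option Move) (Φ : Position) : Position :=
  Φ.filterMap fun l => (f l.2).map fun β => (l.1, β)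

theorem sift_append (f : Move → Option Move) (Φ Ψ : Position) :
    sift f (Φ ++ Ψ) = sift f Φ ++ sift f Ψ := List.filterMap_append

theorem sift_moves (f : Move → Option Move) (p : Player) (L : List Move) :
    sift f (moves p L) = moves p (L.filterMap f) := by
  simp only [sift, moves, List.filterMap_map, List.map_filterMap, Function.comp_def]

theorem sift_singleton (f : Move → Option Move) (p : Player) (α : Move) :
    sift f [(p, α)] = moves p (f α).toList := by
  cases h : f α <;> simp [sift, moves, h]

theorem PassOrMove.sift (h : PassOrMove p Φ Ψ) (f : Move → Option Move) :
    PassOrMove p (sift f Φ) (sift f Ψ) := by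
  rcases h with rfl | ⟨α, rfl⟩
  · exact Or.inl rfl
  · rw [sift_append, sift_singleton]
    cases f α with
    | none => exact Or.inl (List.append_nil _)
    | some β => exact Or.inr ⟨β, rfl⟩

end Replies

/-! ### Negation -/

section Negation

variable {p : Player} {Φ Ψ : Position} {I : Set Position} {legal : Set Position}

/-- The position with all labels reversed. -/
def negate (Φ : Position) : Position := Φ.map LabMove.neg

theorem negate_append (Φ Ψ : Position) : negate (Φ ++ Ψ) = negate Φ ++ negate Ψ :=
  List.map_append

theorem negate_moves (p : Player) (L : List Move) : negate (moves p L) = moves p.other L := by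
  simp only [negate, moves, LabMove.neg, List.map_map, Function.comp_def]

theorem PassOrMove.negate (h : PassOrMove p Φ Ψ) :
    PassOrMove p.other (negate Φ) (negate Ψ) := by
  rcases h with rfl | ⟨α, rfl⟩
  · exact Or.inl rfl
  · exact Or.inr ⟨α, negate_append _ _⟩

theorem Reaches.of_negate (h : Reaches p (negate Φ) I) : Reaches p.other Φ (negate ⁻¹' I) := by
  obtain ⟨L, hL⟩ := h
  exact ⟨L, by rwa [Set.mem_preimage, negate_append, negate_moves, p.other_other]⟩

theorem Maintains.negate (h : Maintains legal p I) :
    Maintains (negate ⁻¹' legal) p.other (negate ⁻¹' I) :=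
  fun Φ hΦ Ψ hΨ hmove =>
    (h (CoL.negate Φ) hΦ (CoL.negate Ψ) hΨ (p.other_other ▸ hmove.negate)).of_negate

end Negation

/-! ### Parallel combinations -/

section Parallel

variable {p : Player} {Φ Ψ : Position} {I J : Set Position} {legal legal' : Set Position}

/-- The position in the `i`th component of a parallel combination. -/
abbrev component (i : Fin 10) : Position → Position := sift (stripComponent i)

/-- The move `i.β`. -/
def componentMove (i : Fin 10) (β : Move) : Move := Key.digit i :: Key.dot :: β

theorem stripComponent_componentMove (i j : Fin 10) (β : Move) :
    stripComponent i (componentMove j β) = if j = i then some β else none := by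
  simp [stripComponent, componentMove]

theorem filterMap_stripComponent (i j : Fin 10) (L : List Move) :
    (L.map (componentMove j)).filterMap (stripComponent i) = if j = i then L else [] := by
  split_ifs with h <;>
    simp [List.filterMap_map, stripComponent_componentMove, h]

/-- All moves of the position are made in the components `1` and `2`. -/
def InComponents (Φ : Position) : Prop :=
  ∀ l ∈ Φ, (inComponent 1 l).isSome ∨ (inComponent 2 l).isSome

theorem inComponents_nil : InComponents [] := fun _ h => absurd h List.not_mem_nil

theorem InComponents.append (hΦ : InComponents Φ) (hΨ : InComponents Ψ) :
    InComponents (Φ ++ Ψ) :=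
  fun l hl => (List.mem_append.1 hl).elim (hΦ l) (hΨ l)

theorem inComponents_moves_one (p : Player) (L : List Move) :
    InComponents (moves p (L.map (componentMove 1))) := by
  simp [InComponents, moves, inComponent, stripComponent_componentMove]

theorem inComponents_moves_two (p : Player) (L : List Move) :
    InComponents (moves p (L.map (componentMove 2))) := by
  simp [InComponents, moves, inComponent, stripComponent_componentMove]

/-- The positions of a parallel combination whose components are in `I` and in `J`, so that
`parLegal A B` is `parPositions A.legal B.legal`. -/
def parPositions (I J : Set Position) : Set Position :=
  {Φ | InComponents Φ ∧ component 1 Φ ∈ I ∧ component 2 Φ ∈ J}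

theorem parPositions_mono {I' J' : Set Position} (hI : I ⊆ I') (hJ : J ⊆ J') :
    parPositions I J ⊆ parPositions I' J' :=
  fun _ h => ⟨h.1, hI h.2.1, hJ h.2.2⟩

theorem Reaches.par (hΦ : InComponents Φ) (hI : Reaches p (component 1 Φ) I)
    (hJ : Reaches p (component 2 Φ) J) : Reaches p Φ (parPositions I J) := by
  obtain ⟨L₁, h₁⟩ := hI
  obtain ⟨L₂, h₂⟩ := hJ
  refine ⟨L₁.map (componentMove 1) ++ L₂.map (componentMove 2), ?_, ?_, ?_⟩
  · rw [moves_append]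
    exact hΦ.append ((inComponents_moves_one p L₁).append (inComponents_moves_two p L₂))
  · rw [component, sift_append, sift_moves, List.filterMap_append, filterMap_stripComponent,
      filterMap_stripComponent, if_pos rfl, if_neg (by decide), List.append_nil]
    exact h₁
  · rw [component, sift_append, sift_moves, List.filterMap_append, filterMap_stripComponent,
      filterMap_stripComponent, if_neg (by decide), if_pos rfl, List.nil_append]
    exact h₂

theorem Maintains.par (hI : Maintains legal p I) (hJ : Maintains legal' p J) :
    Maintains (parPositions legal legal') p (parPositions I J) :=
  fun _ hΦ _ hΨ hmove => .par hΨ.1 (hI _ hΦ.2.1 _ hΨ.2.1 (hmove.sift _))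
    (hJ _ hΦ.2.2 _ hΨ.2.2 (hmove.sift _))

end Parallel

/-! ### Threads -/

section Threads

variable {u w : List Bool} {x : ℕ → Bool}

/-- The finite bit string `w` is an initial segment of the infinite bit string `x`. -/
def Starts (w : List Bool) (x : ℕ → Bool) : Prop := ∃ v, x = appendBits w v

theorem starts_appendBits (w : List Bool) (v : ℕ → Bool) : Starts w (appendBits w v) := ⟨v, rfl⟩

theorem starts_nil (x : ℕ → Bool) : Starts [] x := ⟨x, by simp [funext_iff, appendBits]⟩

theorem starts_cons {b : Bool} : Starts (b :: w) x ↔ b = x 0 ∧ Starts w fun n => x (n + 1) := by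
  constructor
  · rintro ⟨v, rfl⟩
    exact ⟨by simp [appendBits], v, by simp [funext_iff, appendBits]⟩
  · rintro ⟨rfl, v, hv⟩
    refine ⟨v, funext fun n => ?_⟩
    cases n with
    | zero => simp [appendBits]
    | succ n => simpa [appendBits] using congrFun hv n

theorem Starts.append_singleton (h : Starts w x) : Starts (w ++ [x w.length]) x := by
  induction w generalizing x with
  | nil => simp [starts_cons, starts_nil]
  | cons b w ih =>
    rw [starts_cons] at h
    rw [List.cons_append, starts_cons]
    exact ⟨h.1, ih h.2⟩

theorem Starts.of_prefix (h : Starts w x) (huw : u <+: w) : Starts u x := by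
  induction u generalizing w x with
  | nil => exact starts_nil x
  | cons b u ih =>
    cases w with
    | nil => simp at huw
    | cons c w =>
      rw [List.cons_prefix_cons] at huw
      rw [starts_cons] at h ⊢
      exact ⟨huw.1.trans h.1, ih h.2 huw.2⟩

theorem Starts.prefix_or_prefix (hu : Starts u x) (hw : Starts w x) : u <+: w ∨ w <+: u := by
  induction u generalizing w x with
  | nil => exact Or.inl List.nil_prefix
  | cons b u ih =>
    cases w with
    | nil => exact Or.inr List.nil_prefix
    | cons c w =>
      rw [starts_cons] at hu hw
      simpa only [List.cons_prefix_cons, hu.1, hw.1, true_and] using ih hu.2 hw.2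

theorem bitKey_injective : Function.Injective bitKey := by
  intro a b
  cases a <;> cases b <;> simp [bitKey]

theorem bitKey_ne_dot (b : Bool) : bitKey b ≠ Key.dot := by cases b <;> simp [bitKey]

theorem bitKey_ne_colon (b : Bool) : bitKey b ≠ Key.colon := by cases b <;> simp [bitKey]

theorem stripThread_replicative (x : ℕ → Bool) (w : List Bool) :
    stripThread x (replicative w) = none := by
  induction w generalizing x with
  | nil => simp [replicative, stripThread, (bitKey_ne_colon _).symm]
  | cons b w ih =>
    rw [replicative, List.map_cons, List.cons_append, stripThread, if_neg (bitKey_ne_dot b)]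
    exact (ite_eq_right_iff.2 fun _ => ih _)

open Classical in
theorem stripThread_nonReplicative (x : ℕ → Bool) (w : List Bool) (α : Move) :
    stripThread x (nonReplicative w α) = if Starts w x then some α else none := by
  induction w generalizing x with
  | nil => simp [nonReplicative, stripThread, starts_nil]
  | cons b w ih =>
    rw [nonReplicative, List.map_cons, List.cons_append, stripThread, if_neg (bitKey_ne_dot b),
      ← nonReplicative, ih]
    simp only [bitKey_injective.eq_iff, starts_cons, ite_and]

theorem replicative_injective : Function.Injective replicative := fun _ _ h =>
  List.map_injective_iff.2 bitKey_injective (List.append_cancel_right h)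

theorem replicative_ne_nonReplicative (u w : List Bool) (α : Move) :
    replicative u ≠ nonReplicative w α := fun h => by
  simpa [stripThread_replicative, stripThread_nonReplicative, starts_appendBits] using
    congrArg (stripThread (appendBits w fun _ => false)) h

/-- The position `Φ^{≼x}`. -/
abbrev thread (x : ℕ → Bool) : Position → Position := sift (stripThread x)

theorem thread_append (x : ℕ → Bool) (Φ Ψ : Position) :
    thread x (Φ ++ Ψ) = thread x Φ ++ thread x Ψ := sift_append _ Φ Ψ

theorem thread_replicative (x : ℕ → Bool) (p : Player) (w : List Bool) :
    thread x [(p, replicative w)] = [] := by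
  rw [thread, sift_singleton, stripThread_replicative]
  rfl

/-- The position in which the player `p` has made the moves `L` at the node `w`. -/
def movesAt (w : List Bool) (p : Player) (L : List Move) : Position :=
  moves p (L.map (nonReplicative w))

open Classical in
theorem thread_movesAt (x : ℕ → Bool) (w : List Bool) (p : Player) (L : List Move) :
    thread x (movesAt w p L) = if Starts w x then moves p L else [] := by
  rw [thread, movesAt, sift_moves, List.filterMap_map]
  split_ifs with h <;>
    simp [stripThread_nonReplicative, h, moves]

theorem Starts.thread_append_movesAt (h : Starts w x) (Φ : Position) (p : Player)
    (L : List Move) : thread x (Φ ++ movesAt w p L) = thread x Φ ++ moves p L := by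
  rw [thread_append, thread_movesAt, if_pos h]

theorem thread_append_movesAt_of_not_starts (h : ¬ Starts w x) (Φ : Position) (p : Player)
    (L : List Move) : thread x (Φ ++ movesAt w p L) = thread x Φ := by
  rw [thread_append, thread_movesAt, if_neg h, List.append_nil]

end Threads

/-! ### The tree of a position -/

section Tree

variable {A : ConstGame} {p : Player} {Φ Ψ : Position} {l : LabMove} {u w w' : List Bool}

theorem actualNode_append :
    ActualNode (Φ ++ Ψ) w ↔ ActualNode Φ w ∨ ActualNode Ψ w := by
  simp only [ActualNode, List.mem_append]
  grind

theorem actualNode_replicative :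
    ActualNode [(p, replicative u)] w ↔ w = [] ∨ ∃ b, w = u ++ [b] := by
  simp only [ActualNode, List.mem_singleton, Prod.mk.injEq, replicative_injective.eq_iff]
  grind

theorem actualNode_append_movesAt {L : List Move} :
    ActualNode (Φ ++ movesAt u p L) w ↔ ActualNode Φ w := by
  refine actualNode_append.trans (or_iff_left_of_imp ?_)
  rintro (h | ⟨u', b, q, -, h⟩)
  · exact Or.inl h
  · simp only [movesAt, moves, List.mem_map, Prod.mk.injEq] at h
    obtain ⟨-, ⟨α, -, rfl⟩, -, h⟩ := h
    exact absurd h.symm (replicative_ne_nonReplicative _ _ _)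

theorem isLeaf_append_movesAt {L : List Move} : IsLeaf (Φ ++ movesAt u p L) w ↔ IsLeaf Φ w := by
  simp only [IsLeaf, actualNode_append_movesAt]

theorem actualNode_append_replicative :
    ActualNode (Φ ++ [(p, replicative u)]) w ↔ ActualNode Φ w ∨ ∃ b, w = u ++ [b] := by
  rw [actualNode_append, actualNode_replicative, ← or_assoc]
  exact or_congr_left (or_iff_left_of_imp Or.inl)

theorem IsLeaf.append_replicative (hw : IsLeaf Φ w) (hw' : IsLeaf Φ w') (hne : w' ≠ w) :
    IsLeaf (Φ ++ [(p, replicative w)]) w' := by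
  refine ⟨actualNode_append_replicative.2 (Or.inl hw'.1), fun u hu h => ?_⟩
  rcases actualNode_append_replicative.1 hu with hu | ⟨b, rfl⟩
  · exact hw'.2 u hu h
  · rcases List.prefix_concat_iff.1 h with h | h
    · exact h.symm
    · exact absurd (hw'.2 w hw.1 h).symm hne

theorem IsLeaf.child (hw : IsLeaf Φ w) (b : Bool) :
    IsLeaf (Φ ++ [(p, replicative w)]) (w ++ [b]) := by
  refine ⟨actualNode_append_replicative.2 (Or.inr ⟨b, rfl⟩), fun u hu h => ?_⟩
  rcases actualNode_append_replicative.1 hu with hu | ⟨c, rfl⟩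
  · have := hw.2 u hu ((List.prefix_append _ _).trans h) ▸ h.length_le
    simp at this
  · exact (h.eq_of_length (by simp)).symm

theorem nil_mem_branchLegal : [] ∈ branchLegal A := (A.branch .uncountable).nil_legal

theorem branchLegal_append_singleton :
    Φ ++ [l] ∈ branchLegal A ↔ Φ ∈ branchLegal A ∧ BranchLegalMove A Φ l := by
  constructor
  · exact fun h => ⟨fun Ψ l' h' => h Ψ l' (h'.trans (List.prefix_append _ _)),
      h Φ l List.prefix_rfl⟩
  · rintro ⟨hΦ, hl⟩ Ψ l' h
    rcases List.prefix_concat_iff.1 h with h | h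
    · obtain ⟨rfl, rfl⟩ := List.append_singleton_inj.1 h
      exact hl
    · exact hΦ Ψ l' h

theorem thread_mem_legal (h : Φ ∈ branchLegal A) (x : ℕ → Bool) : thread x Φ ∈ A.legal := by
  induction Φ using List.reverseRecOn with
  | nil => exact A.nil_legal
  | append_singleton Φ l ih =>
    obtain ⟨hΦ, ⟨w, -, rfl⟩ | ⟨w, p, α, -, rfl, hα⟩⟩ := branchLegal_append_singleton.1 h
    · rw [thread_append, thread_replicative, List.append_nil]
      exact ih hΦ
    · by_cases hw : Starts w x
      · obtain ⟨v, rfl⟩ := hw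
        exact (starts_appendBits w v).thread_append_movesAt Φ p [α] ▸ hα v
      · exact (thread_append_movesAt_of_not_starts hw Φ p [α]).symm ▸ ih hΦ

theorem exists_leaves (h : Φ ∈ branchLegal A) :
    ∃ ℓ : List (List Bool), (∀ w ∈ ℓ, IsLeaf Φ w) ∧ ∀ x, ∃ w ∈ ℓ, Starts w x := by
  induction Φ using List.reverseRecOn with
  | nil =>
    refine ⟨[[]], ?_, fun x => ⟨[], by simp, starts_nil x⟩⟩
    simp [IsLeaf, ActualNode]
  | append_singleton Φ l ih =>
    obtain ⟨hΦ, ⟨w, hw, rfl⟩ | ⟨w, p, α, -, rfl, -⟩⟩ := branchLegal_append_singleton.1 h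
    · obtain ⟨ℓ, hℓ, hcover⟩ := ih hΦ
      refine ⟨(w ++ [false]) :: (w ++ [true]) :: ℓ.filter (· ≠ w), ?_, fun x => ?_⟩
      · simp only [List.mem_cons, List.mem_filter, decide_eq_true_eq]
        rintro w' (rfl | rfl | ⟨hw', hne⟩)
        · exact hw.child false
        · exact hw.child true
        · exact hw.append_replicative (hℓ _ hw') hne
      · obtain ⟨w', hw', hx⟩ := hcover x
        by_cases hne : w' = w
        · refine ⟨_, ?_, hx.append_singleton⟩
          cases x w'.length <;> simp [hne]
        · exact ⟨w', by simp [hw', hne], hx⟩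
    · obtain ⟨ℓ, hℓ, hcover⟩ := ih hΦ
      exact ⟨ℓ, fun w' hw' => isLeaf_append_movesAt (L := [α]).2 (hℓ w' hw'), hcover⟩

theorem exists_actualNode_of_mem (h : Φ ∈ branchLegal A) (hl : l ∈ Φ) :
    (∃ u, l.2 = replicative u) ∨ ∃ u α, ActualNode Φ u ∧ l.2 = nonReplicative u α := by
  obtain ⟨Ψ, Ψ', rfl⟩ := List.append_of_mem hl
  rcases h Ψ l ⟨Ψ', by simp⟩ with ⟨u, -, rfl⟩ | ⟨u, p, α, hu, rfl, -⟩
  · exact Or.inl ⟨u, rfl⟩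
  · exact Or.inr ⟨u, α, actualNode_append.2 (Or.inl hu), rfl⟩

open Classical in
theorem IsLeaf.thread_eq (hw : IsLeaf Φ w) (h : Φ ∈ branchLegal A) {x x' : ℕ → Bool}
    (hx : Starts w x) (hx' : Starts w x') : thread x Φ = thread x' Φ := by
  have starts_of_actualNode : ∀ {u y y'}, ActualNode Φ u → Starts w y → Starts w y' →
      Starts u y → Starts u y' := by
    intro u y y' hu hy hy' huy
    rcases huy.prefix_or_prefix hy with huw | hwu
    · exact hy'.of_prefix huw
    · exact hw.2 u hu hwu ▸ hy'
  refine List.filterMap_congr fun l hl => ?_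
  rcases exists_actualNode_of_mem h hl with ⟨u, hu⟩ | ⟨u, α, hu, hα⟩
  · rw [hu, stripThread_replicative, stripThread_replicative]
  · rw [hα, stripThread_nonReplicative, stripThread_nonReplicative]
    exact congrArg _ (if_congr
      ⟨starts_of_actualNode hu hx hx', starts_of_actualNode hu hx' hx⟩ rfl rfl)

theorem append_movesAt_mem_branchLegal (h : Φ ∈ branchLegal A) (hw : ActualNode Φ w)
    {L : List Move} (hL : ∀ x, Starts w x → thread x Φ ++ moves p L ∈ A.legal) :
    Φ ++ movesAt w p L ∈ branchLegal A := by
  induction L using List.reverseRecOn with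
  | nil => simpa [movesAt, moves] using h
  | append_singleton L α ih =>
    simp only [moves_append, ← List.append_assoc] at hL
    rw [movesAt, List.map_append, moves_append, ← List.append_assoc, ← movesAt]
    refine branchLegal_append_singleton.2
      ⟨ih fun x hx => A.prefix_legal (List.prefix_append _ _) (hL x hx),
        Or.inr ⟨w, p, α, actualNode_append_movesAt.2 hw, rfl, fun v => ?_⟩⟩
    have hv := starts_appendBits w v
    change thread (appendBits w v) (Φ ++ movesAt w p L) ++ moves p [α] ∈ A.legal
    exact (hv.thread_append_movesAt Φ p L).symm ▸ hL _ hv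

end Tree

/-! ### Branching recurrences -/

section Recurrences

variable {A : ConstGame} {p : Player} {Φ Ψ : Position} {I : Set Position} {w : List Bool}

/-- The legal positions of a branching recurrence of `A` all threads of which are in `I`. -/
def branchPositions (A : ConstGame) (I : Set Position) : Set Position :=
  {Φ ∈ branchLegal A | ∀ x, thread x Φ ∈ I}

/-- Since all threads through a leaf agree, moves made at the leaf can serve them all. -/
theorem IsLeaf.exists_movesAt (hw : IsLeaf Φ w) (hΦ : Φ ∈ branchLegal A) (hI : I ⊆ A.legal)
    (hreach : ∀ x, Reaches p (thread x Φ) I) :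
    ∃ L, Φ ++ movesAt w p L ∈ branchLegal A ∧
      ∀ x, Starts w x → thread x (Φ ++ movesAt w p L) ∈ I := by
  obtain ⟨L, hL⟩ := hreach (appendBits w fun _ => false)
  have hLI : ∀ x, Starts w x → thread x Φ ++ moves p L ∈ I := fun x hx =>
    hw.thread_eq hΦ hx (starts_appendBits w _) ▸ hL
  exact ⟨L, append_movesAt_mem_branchLegal hΦ hw.1 fun x hx => hI (hLI x hx),
    fun x hx => hx.thread_append_movesAt Φ p L ▸ hLI x hx⟩

theorem Reaches.at_leaves (hΦ : Φ ∈ branchLegal A) (hI : I ⊆ A.legal)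
    (hreach : ∀ x, Reaches p (thread x Φ) I) {ℓ : List (List Bool)} (hℓ : ∀ w ∈ ℓ, IsLeaf Φ w) :
    Reaches p Φ {Ψ ∈ branchLegal A | (∀ w, IsLeaf Φ w → IsLeaf Ψ w) ∧
      (∀ x, Reaches p (thread x Ψ) I) ∧ ∀ w ∈ ℓ, ∀ x, Starts w x → thread x Ψ ∈ I} := by
  induction ℓ with
  | nil => exact .of_mem ⟨hΦ, fun _ h => h, hreach, by simp⟩
  | cons w ℓ ih =>
    rw [List.forall_mem_cons] at hℓ
    refine (ih hℓ.2).trans fun Ψ ⟨hΨ, hleaf, hΨreach, hΨℓ⟩ => ?_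
    obtain ⟨L, hlegal, hthread⟩ := (hleaf w hℓ.1).exists_movesAt hΨ hI hΨreach
    refine ⟨L.map (nonReplicative w), hlegal,
      fun u hu => isLeaf_append_movesAt.2 (hleaf u hu), fun x => ?_, fun u hu x hux => ?_⟩ <;>
    by_cases hx : Starts w x
    · exact .of_mem (hthread x hx)
    · exact (thread_append_movesAt_of_not_starts hx Ψ p L).symm ▸ hΨreach x
    · exact hthread x hx
    · refine (thread_append_movesAt_of_not_starts hx Ψ p L).symm ▸
        hΨℓ u ((List.mem_cons.1 hu).resolve_left ?_) x hux
      exact fun huw => hx (huw ▸ hux)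

theorem Reaches.branch (hΦ : Φ ∈ branchLegal A) (hI : I ⊆ A.legal)
    (hreach : ∀ x, Reaches p (thread x Φ) I) : Reaches p Φ (branchPositions A I) := by
  obtain ⟨ℓ, hℓ, hcover⟩ := exists_leaves hΦ
  refine (Reaches.at_leaves hΦ hI hreach hℓ).mono fun Ψ hΨ => ⟨hΨ.1, fun x => ?_⟩
  obtain ⟨w, hw, hx⟩ := hcover x
  exact hΨ.2.2.2 w hw x hx

theorem Maintains.branch (h : Maintains A.legal p I) (hI : I ⊆ A.legal) :
    Maintains (branchLegal A) p (branchPositions A I) :=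
  fun _ hΦ _ hΨ hmove => .branch hΨ hI fun x =>
    h _ (hΦ.2 x) _ (thread_mem_legal hΨ x) (hmove.sift _)

end Recurrences

/-! ### The game `⊔x⊓y R(x, y)` -/

section ChoiceGame

variable {R : ℕ → ℕ → Prop} {c c' d : ℕ} {s s' : Option ℕ} {Φ Ψ : Position}

theorem numeral_injective : Function.Injective numeral := by
  let value : Key → ℕ
    | Key.digit d => d.val
    | _ => 0
  suffices hleft : ∀ n, Nat.ofDigits 10 ((numeral n).reverse.map value) = n from
    (show Function.LeftInverse (fun α => Nat.ofDigits 10 (α.reverse.map value)) numeral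
      from hleft).injective
  intro n
  by_cases hn : n = 0
  · simp [hn, numeral, value]
  · have hvalue : ∀ d ∈ Nat.digits 10 n, value (Key.digit (Fin.ofNat 10 d)) = d := fun d hd =>
      Nat.mod_eq_of_lt (Nat.digits_lt_base (by norm_num) hd)
    rw [numeral, if_neg hn, ← List.map_reverse, List.reverse_reverse, List.map_map]
    exact (congrArg (Nat.ofDigits 10) ((List.map_congr_left hvalue).trans (List.map_id _))).trans
      (Nat.ofDigits_digits 10 n)

/-- The constant game `⊔x⊓y R(x, y)`. -/
noncomputable def choiceGame (R : ℕ → ℕ → Prop) : ConstGame :=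
  ConstGame.chooseEx fun c => ConstGame.chooseAll fun d => ConstGame.elementary (R c d)

/-- The position of `⊔x⊓y R(x, y)` in which the machine has chosen `c` for `x` and the environment
has chosen the value of `s`, if there is one, for `y`. -/
def chosen (c : ℕ) (s : Option ℕ) : Position :=
  (Player.machine, numeral c) :: moves Player.environment (s.map numeral).toList

theorem chosen_prefix_chosen : chosen c s <+: chosen c' s' ↔ c = c' ∧ (s = none ∨ s = s') := by
  cases s <;> cases s' <;>
    simp [chosen, moves, List.cons_prefix_cons, numeral_injective.eq_iff]

theorem mem_choiceGame_legal : Φ ∈ (choiceGame R).legal ↔ Φ = [] ∨ ∃ c s, Φ = chosen c s := by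
  constructor
  · rintro (rfl | ⟨c, Δ, rfl, rfl | ⟨d, Δ', rfl, rfl⟩⟩)
    · exact Or.inl rfl
    · exact Or.inr ⟨c, none, rfl⟩
    · exact Or.inr ⟨c, some d, rfl⟩
  · rintro (rfl | ⟨c, s, rfl⟩)
    · exact Or.inl rfl
    · refine Or.inr ⟨c, _, rfl, ?_⟩
      cases s with
      | none => exact Or.inl rfl
      | some d => exact Or.inr ⟨d, [], rfl, rfl⟩

theorem chosen_mem_legal (c : ℕ) (s : Option ℕ) : chosen c s ∈ (choiceGame R).legal :=
  mem_choiceGame_legal.2 (Or.inr ⟨c, s, rfl⟩)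

theorem PassOrMove.of_nil_machine (h : PassOrMove Player.machine [] Ψ)
    (hΨ : Ψ ∈ (choiceGame R).legal) : Ψ = [] ∨ ∃ c, Ψ = chosen c none := by
  rcases h with rfl | ⟨α, rfl⟩
  · exact Or.inl rfl
  · obtain h | ⟨c, _ | d, h⟩ := mem_choiceGame_legal.1 hΨ
    · exact Or.inl h
    · exact Or.inr ⟨c, h⟩
    · simp [chosen, moves] at h

theorem PassOrMove.of_nil_environment (h : PassOrMove Player.environment [] Ψ)
    (hΨ : Ψ ∈ (choiceGame R).legal) : Ψ = [] := by
  rcases h with rfl | ⟨α, rfl⟩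
  · rfl
  · obtain h | ⟨c, s, h⟩ := mem_choiceGame_legal.1 hΨ
    · exact h
    · simp [chosen] at h

theorem PassOrMove.of_chosen {p : Player} (h : PassOrMove p (chosen c s) Ψ)
    (hΨ : Ψ ∈ (choiceGame R).legal) : ∃ s', Ψ = chosen c s' ∧ (s = none ∨ s = s') := by
  obtain rfl | ⟨c', s', rfl⟩ := mem_choiceGame_legal.1 hΨ
  · simpa [chosen] using h.prefix
  · obtain ⟨rfl, hs⟩ := chosen_prefix_chosen.1 h.prefix
    exact ⟨s', rfl, hs⟩

theorem PassOrMove.of_chosen_machine (h : PassOrMove Player.machine (chosen c s) Ψ)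
    (hΨ : Ψ ∈ (choiceGame R).legal) : Ψ = chosen c s := by
  obtain ⟨s', rfl, rfl | rfl⟩ := h.of_chosen hΨ
  · cases s' <;> simp_all [PassOrMove, chosen, moves]
  · rfl

theorem reaches_chosen (hs : s = none ∨ s = s') :
    Reaches Player.environment (chosen c s) {chosen c s'} := by
  obtain rfl | rfl := hs
  · exact ⟨(s'.map numeral).toList, rfl⟩
  · exact .of_mem rfl

end ChoiceGame

/-! ### Duplication -/

section Duplication

variable {R : ℕ → ℕ → Prop} {S : Set ℕ} {Φ Φ₀ Φ₁ Φ₂ Ψ₀ Ψ₁ Ψ₂ : Position}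

/-- The constant game `P → P ∧ P`. -/
noncomputable def duplication (P : ConstGame) : ConstGame := P.neg.por (P.pand P)

/-- The positions of `P → P ∧ P` in which `Φ₀`, `Φ₁` and `Φ₂` have been played in the three copies
of `P`, the players being interchanged in the first one. -/
def parts (Φ₀ Φ₁ Φ₂ : Position) : Set Position :=
  parPositions (negate ⁻¹' {Φ₀}) (parPositions {Φ₁} {Φ₂})

theorem parts_subset_legal {P : ConstGame} (h₀ : Φ₀ ∈ P.legal) (h₁ : Φ₁ ∈ P.legal)
    (h₂ : Φ₂ ∈ P.legal) : parts Φ₀ Φ₁ Φ₂ ⊆ (duplication P).legal :=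
  parPositions_mono (Set.preimage_mono (Set.singleton_subset_iff.2 h₀))
    (parPositions_mono (Set.singleton_subset_iff.2 h₁) (Set.singleton_subset_iff.2 h₂))

theorem reaches_parts (hΦ : Φ ∈ parts Φ₀ Φ₁ Φ₂) (h₀ : Reaches Player.environment Φ₀ {Ψ₀})
    (h₁ : Reaches Player.machine Φ₁ {Ψ₁}) (h₂ : Reaches Player.machine Φ₂ {Ψ₂}) :
    Reaches Player.machine Φ (parts Ψ₀ Ψ₁ Ψ₂) := by
  obtain ⟨hcomp, rfl, hcomp', rfl, rfl⟩ := hΦ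
  exact .par hcomp h₀.of_negate (.par hcomp' h₁ h₂)

theorem PassOrMove.of_mem_parts {Ψ : Position} (hmove : PassOrMove Player.environment Φ Ψ)
    (hΦ : Φ ∈ parts Φ₀ Φ₁ Φ₂) {P : ConstGame} (hΨ : Ψ ∈ (duplication P).legal) :
    ∃ Ψ₀ ∈ P.legal, ∃ Ψ₁ ∈ P.legal, ∃ Ψ₂ ∈ P.legal, Ψ ∈ parts Ψ₀ Ψ₁ Ψ₂ ∧
      PassOrMove Player.machine Φ₀ Ψ₀ ∧ PassOrMove Player.environment Φ₁ Ψ₁ ∧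
      PassOrMove Player.environment Φ₂ Ψ₂ := by
  obtain ⟨-, rfl, -, rfl, rfl⟩ := hΦ
  exact ⟨_, hΨ.2.1, _, hΨ.2.2.2.1, _, hΨ.2.2.2.2, ⟨hΨ.1, rfl, hΨ.2.2.1, rfl, rfl⟩,
    (hmove.sift _).negate, (hmove.sift _).sift _, (hmove.sift _).sift _⟩

open Classical in
/-- The answer to the choice of `a` in the antecedent of `P → P ∧ P`: a copy of the answer to the
child of `a` that is in the set `S`. -/
noncomputable def answer (S : Set ℕ) (a : ℕ) (s₁ s₂ : Option ℕ) : Option ℕ :=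
  if 2 * a + 1 ∈ S then s₁ else if 2 * a + 2 ∈ S then s₂ else none

theorem answer_empty (a : ℕ) (s₁ s₂ : Option ℕ) : answer ∅ a s₁ s₂ = none := by simp [answer]

theorem answer_update {s₁ s₂ s₁' s₂' : Option ℕ} (a : ℕ) (h₁ : s₁ = none ∨ s₁ = s₁')
    (h₂ : s₂ = none ∨ s₂ = s₂') :
    answer S a s₁ s₂ = none ∨ answer S a s₁ s₂ = answer S a s₁' s₂' := by
  unfold answer
  split_ifs
  exacts [h₁, h₂, Or.inl rfl]

/-- The positions of `P → P ∧ P` at which the machine aims, where `P` is `⊔x⊓y R(x, y)` and `a` has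
been chosen in the antecedent: the machine has chosen the children `2a + 1` and `2a + 2` in the
consequent, and of the answers to the children in `S` it has made an answer to `a`. -/
def SettledAt (S : Set ℕ) (a : ℕ) : Set Position :=
  {Φ | ∃ s₁ s₂, Φ ∈ parts (chosen a (answer S a s₁ s₂)) (chosen (2 * a + 1) s₁)
    (chosen (2 * a + 2) s₂)}

/-- The positions of `P → P ∧ P` at which the machine aims, where `P` is `⊔x⊓y R(x, y)`. -/
def Settled (S : Set ℕ) : Set Position := parts [] [] [] ∪ {Φ | ∃ a, Φ ∈ SettledAt S a}

theorem settled_subset_legal : Settled S ⊆ (duplication (choiceGame R)).legal := by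
  rintro Φ (h | ⟨a, s₁, s₂, h⟩)
  · have hnil : [] ∈ (choiceGame R).legal := (choiceGame R).nil_legal
    exact parts_subset_legal hnil hnil hnil h
  · exact parts_subset_legal (chosen_mem_legal _ _) (chosen_mem_legal _ _)
      (chosen_mem_legal _ _) h

theorem reaches_settled {a : ℕ} {s s₁ s₂ : Option ℕ}
    (hΦ : Φ ∈ parts (chosen a s) Φ₁ Φ₂) (hs : s = none ∨ s = answer S a s₁ s₂)
    (h₁ : Reaches Player.machine Φ₁ {chosen (2 * a + 1) s₁})
    (h₂ : Reaches Player.machine Φ₂ {chosen (2 * a + 2) s₂}) :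
    Reaches Player.machine Φ (Settled S) :=
  (reaches_parts hΦ (reaches_chosen hs) h₁ h₂).mono fun _ h => Or.inr ⟨a, s₁, s₂, h⟩

theorem reaches_settled_of_mem_settled_empty (hΦ : Φ ∈ Settled ∅) :
    Reaches Player.machine Φ (Settled S) := by
  obtain h | ⟨a, s₁, s₂, h⟩ := hΦ
  · exact .of_mem (Or.inl h)
  · exact reaches_settled h (Or.inl (answer_empty a s₁ s₂)) (.of_mem rfl) (.of_mem rfl)

theorem maintains_settled :
    Maintains (duplication (choiceGame R)).legal Player.machine (Settled S) := by
  rintro Φ (hΦ | ⟨a, s₁, s₂, hΦ⟩) Ψ hΨ hmove <;>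
  obtain ⟨Ψ₀, hΨ₀, Ψ₁, hΨ₁, Ψ₂, hΨ₂, hΨ, hmove₀, hmove₁, hmove₂⟩ :=
    PassOrMove.of_mem_parts hmove hΦ hΨ
  · obtain rfl := hmove₁.of_nil_environment hΨ₁
    obtain rfl := hmove₂.of_nil_environment hΨ₂
    obtain rfl | ⟨a, rfl⟩ := hmove₀.of_nil_machine hΨ₀
    · exact .of_mem (Or.inl hΨ)
    · exact reaches_settled (s₁ := none) (s₂ := none) hΨ (Or.inl rfl)
        ⟨[numeral (2 * a + 1)], rfl⟩ ⟨[numeral (2 * a + 2)], rfl⟩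
  · obtain rfl := hmove₀.of_chosen_machine hΨ₀
    obtain ⟨s₁', rfl, hs₁⟩ := hmove₁.of_chosen hΨ₁
    obtain ⟨s₂', rfl, hs₂⟩ := hmove₂.of_chosen hΨ₂
    exact reaches_settled hΨ (answer_update a hs₁ hs₂) (.of_mem rfl) (.of_mem rfl)

end Duplication

/-! ### The strategy of the environment -/

section Ancestors

/-- The node `m` and its ancestors in the infinite binary tree in which the children of `a` are
`2a + 1` and `2a + 2`. -/
def ancestors (m : ℕ) : Set ℕ := {c | ∃ k, (fun n => (n - 1) / 2)^[k] m = c}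

theorem parent_mem_ancestors {m c : ℕ} (h : c ∈ ancestors m) : (c - 1) / 2 ∈ ancestors m := by
  obtain ⟨k, rfl⟩ := h
  exact ⟨k + 1, Function.iterate_succ_apply' _ _ _⟩

theorem ancestors_subset_Iic (m : ℕ) : ancestors m ⊆ Set.Iic m := by
  rintro _ ⟨k, rfl⟩
  exact Function.iterate_le_id_of_le_id
    (fun n => (Nat.div_le_self _ _).trans (Nat.sub_le _ _)) k m

theorem mem_ancestors_or_mem_ancestors {m c c' : ℕ} (hc : c ∈ ancestors m)
    (hc' : c' ∈ ancestors m) : c ∈ ancestors c' ∨ c' ∈ ancestors c := by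
  obtain ⟨k, rfl⟩ := hc
  obtain ⟨l, rfl⟩ := hc'
  rcases le_total k l with h | h
  · exact Or.inr ⟨l - k, by rw [← Function.iterate_add_apply, Nat.sub_add_cancel h]⟩
  · exact Or.inl ⟨k - l, by rw [← Function.iterate_add_apply, Nat.sub_add_cancel h]⟩

theorem not_both_children_mem_ancestors {m a : ℕ} (h₁ : 2 * a + 1 ∈ ancestors m)
    (h₂ : 2 * a + 2 ∈ ancestors m) : False := by
  obtain h | ⟨_ | k, hk⟩ := mem_ancestors_or_mem_ancestors h₂ h₁
  · have := ancestors_subset_Iic _ h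
    grind
  · exact absurd hk (by simp)
  · have := ancestors_subset_Iic _ ⟨k, hk⟩
    grind

/-- A set of nodes of the binary tree that contains, with a node, its parent, and at most one
child of every node. -/
structure IsPath (S : Set ℕ) : Prop where
  parent_mem : ∀ {a}, 2 * a + 1 ∈ S ∨ 2 * a + 2 ∈ S → a ∈ S
  not_both : ∀ {a}, 2 * a + 1 ∈ S → 2 * a + 2 ∉ S

theorem isPath_ancestors (m : ℕ) : IsPath (ancestors m) where
  parent_mem := by
    rintro a (h | h)
    · exact (by omega : (2 * a + 1 - 1) / 2 = a) ▸ parent_mem_ancestors h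
    · exact (by omega : (2 * a + 2 - 1) / 2 = a) ▸ parent_mem_ancestors h
  not_both := not_both_children_mem_ancestors

end Ancestors

section Fork

variable {R : ℕ → ℕ → Prop} {m : ℕ} {Ψ : Position}

/-- The position of a branching recurrence of `⊔x⊓y R(x, y)` in which the machine has chosen `m`,
and then the environment has answered `0` in one copy and `1` in another one. -/
def fork (m : ℕ) : Position :=
  movesAt [] Player.machine [numeral m] ++ [(Player.environment, replicative [])] ++
    movesAt [false] Player.environment [numeral 0] ++
    movesAt [true] Player.environment [numeral 1]

theorem thread_fork (x : ℕ → Bool) (m : ℕ) :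
    thread x (fork m) = chosen m (some (if x 0 then 1 else 0)) := by
  rw [fork, thread_append, thread_append, thread_append, thread_replicative]
  cases hx : x 0 <;> simp [thread_movesAt, starts_nil, starts_cons, hx, chosen, moves]

theorem fork_mem_branchLegal (m : ℕ) : fork m ∈ branchLegal (choiceGame R) := by
  let Θ : Position := [] ++ movesAt [] Player.machine [numeral m]
  have hchoice : Θ ∈ branchLegal (choiceGame R) :=
    append_movesAt_mem_branchLegal nil_mem_branchLegal (Or.inl rfl)
      fun x _ => chosen_mem_legal m none
  have hleaf : IsLeaf Θ [] := isLeaf_append_movesAt.2 (by simp [IsLeaf, ActualNode])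
  have hsplit := branchLegal_append_singleton.2 ⟨hchoice, Or.inl ⟨[], hleaf, rfl⟩⟩
  have hnode (b : Bool) : ActualNode (Θ ++ [(Player.environment, replicative [])]) [b] :=
    actualNode_append_replicative.2 (Or.inr ⟨b, rfl⟩)
  have hthread (x) : thread x (Θ ++ [(Player.environment, replicative [])]) = chosen m none := by
    rw [thread_append, thread_replicative, (starts_nil x).thread_append_movesAt]
    rfl
  refine append_movesAt_mem_branchLegal (append_movesAt_mem_branchLegal hsplit (hnode false)
    fun x _ => ?_) (actualNode_append_movesAt.2 (hnode true)) fun x hx => ?_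
  · rw [hthread]
    exact chosen_mem_legal m (some 0)
  · have hnot : ¬ Starts [false] x := by
      rw [starts_cons] at hx ⊢
      simp [← hx.1]
    rw [thread_append_movesAt_of_not_starts hnot, hthread]
    exact chosen_mem_legal m (some 1)

theorem PassOrMove.of_fork (h : PassOrMove Player.machine (fork m) Ψ)
    (hΨ : Ψ ∈ branchLegal (choiceGame R)) : Ψ = fork m := by
  rcases h with rfl | ⟨β, rfl⟩
  · rfl
  · obtain ⟨-, ⟨w, -, hl⟩ | ⟨w, p, α, -, hl, hα⟩⟩ := branchLegal_append_singleton.1 hΨ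
    · simp at hl
    · obtain ⟨rfl, rfl⟩ := Prod.mk.inj hl
      have hlegal : thread (appendBits w fun _ => false) (fork m) ++ [(Player.machine, α)] ∈
        (choiceGame R).legal := hα fun _ => false
      rw [thread_fork] at hlegal
      simpa using PassOrMove.of_chosen_machine (Or.inr ⟨α, rfl⟩) hlegal

theorem PassOrMove.of_nil_branch (h : PassOrMove Player.machine [] Ψ)
    (hΨ : Ψ ∈ branchLegal (choiceGame R)) :
    Ψ = [] ∨ ∃ m, Ψ = movesAt [] Player.machine [numeral m] := by
  rcases h with rfl | ⟨β, rfl⟩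
  · exact Or.inl rfl
  · obtain ⟨-, ⟨w, -, hl⟩ | ⟨w, p, α, hw, hl, hα⟩⟩ := branchLegal_append_singleton.1 hΨ
    · simp at hl
    · obtain ⟨rfl, rfl⟩ := Prod.mk.inj hl
      obtain rfl : w = [] := by simpa [ActualNode] using hw
      obtain h | ⟨m, h⟩ := PassOrMove.of_nil_machine (R := R) (Or.inr ⟨α, rfl⟩)
        (hα fun _ => false)
      · simp at h
      · obtain rfl : α = numeral m := by simpa [chosen, moves] using h
        exact Or.inr ⟨m, rfl⟩

end Fork

section Strategy

variable {R : ℕ → ℕ → Prop} {S : Set ℕ} {Φ Ψ : Position}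

/-- The constant game `P ∧ !(P → P ∧ P) → !P`. -/
noncomputable def production (r : Recurrence) (P : ConstGame) : ConstGame :=
  (P.pand ((duplication P).branch r)).neg.por (P.branch r)

/-- The positions of the antecedent of `P ∧ !(P → P ∧ P) → !P` at which the environment aims,
where `P` is `⊔x⊓y R(x, y)`: it chooses `0` in `P`, and plays every thread of `!(P → P ∧ P)`
according to `Settled S`. -/
def resources (R : ℕ → ℕ → Prop) (S : Set ℕ) : Set Position :=
  negate ⁻¹' parPositions (Set.range (chosen 0))
    (branchPositions (duplication (choiceGame R)) (Settled S))

theorem maintains_range_chosen (c : ℕ) :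
    Maintains (choiceGame R).legal Player.machine (Set.range (chosen c)) := by
  rintro _ ⟨s, rfl⟩ Ψ hΨ hmove
  obtain ⟨s', rfl, -⟩ := PassOrMove.of_chosen hmove hΨ
  exact .of_mem ⟨s', rfl⟩

theorem maintains_resources :
    Maintains ((choiceGame R).pand ((duplication (choiceGame R)).branch r)).neg.legal
      Player.environment (resources R S) :=
  ((maintains_range_chosen 0).par (maintains_settled.branch settled_subset_legal)).negate

theorem reaches_resources_nil : Reaches Player.environment [] (resources R S) :=
  Reaches.of_negate (p := Player.machine) <| .par inComponents_nil
    ⟨[numeral 0], none, rfl⟩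
    (.branch nil_mem_branchLegal settled_subset_legal fun _ =>
      .of_mem (Or.inl ⟨inComponents_nil, rfl, inComponents_nil, rfl, rfl⟩))

theorem reaches_resources (hΦ : Φ ∈ resources R ∅) :
    Reaches Player.environment Φ (resources R S) :=
  Reaches.of_negate (p := Player.machine) <| .par hΦ.1 (.of_mem hΦ.2.1)
    (.branch hΦ.2.2.1 settled_subset_legal fun x =>
      reaches_settled_of_mem_settled_empty (hΦ.2.2.2 x))

/-- The nodes of the binary tree that the environment uses once the machine has chosen `m` in the
consequent (`some m`), or as long as it has chosen nothing there (`none`). -/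
def path : Option ℕ → Set ℕ
  | none => ∅
  | some m => ancestors m

theorem isPath_path (s : Option ℕ) : IsPath (path s) :=
  match s with
  | none => ⟨by simp [path], by simp [path]⟩
  | some m => isPath_ancestors m

/-- The position of the consequent at which the environment aims, depending on the choice of the
machine there. -/
def goalPosition : Option ℕ → Position
  | none => []
  | some m => fork m

theorem goalPosition_mem_branchLegal (s : Option ℕ) :
    goalPosition s ∈ branchLegal (choiceGame R) :=
  match s with
  | none => nil_mem_branchLegal
  | some m => fork_mem_branchLegal m

/-- The positions of `P ∧ !(P → P ∧ P) → !P` at which the environment aims, depending on the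
choice of the machine in the consequent. -/
def onTrack (R : ℕ → ℕ → Prop) (s : Option ℕ) : Set Position :=
  parPositions (resources R (path s)) {goalPosition s}

-- The legal positions of `⊔x⊓y R(x, y)` do not depend on `R`.
theorem onTrack_congr (R R' : ℕ → ℕ → Prop) : onTrack R = onTrack R' := rfl

theorem onTrack_subset_legal (r : Recurrence) (s : Option ℕ) :
    onTrack R s ⊆ (production r (choiceGame R)).legal := by
  refine parPositions_mono (Set.preimage_mono (parPositions_mono ?_ (Set.sep_subset _ _)))
    (Set.singleton_subset_iff.2 (goalPosition_mem_branchLegal s))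
  rintro _ ⟨s, rfl⟩
  exact chosen_mem_legal 0 s

theorem reaches_onTrack_nil (R : ℕ → ℕ → Prop) :
    Reaches Player.environment [] (⋃ s, onTrack R s) :=
  (Reaches.par inComponents_nil reaches_resources_nil (.of_mem (I := {[]}) rfl)).mono
    (Set.subset_iUnion (onTrack R) none)

theorem maintains_onTrack (r : Recurrence) :
    Maintains (production r (choiceGame R)).legal Player.environment (⋃ s, onTrack R s) := by
  intro Φ hΦ Ψ ⟨hcomp, hΨ₁, hΨ₂⟩ hmove
  obtain ⟨s, -, hΦ₁, hΦ₂⟩ := Set.mem_iUnion.1 hΦ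
  have hresources := maintains_resources _ hΦ₁ _ hΨ₁ (hmove.sift _)
  have hgoal : PassOrMove Player.machine (goalPosition s) (component 2 Ψ) :=
    Set.mem_singleton_iff.1 hΦ₂ ▸ hmove.sift _
  have reaches_onTrack {s'}
      (h₁ : Reaches Player.environment (component 1 Ψ) (resources R (path s')))
      (h₂ : Reaches Player.environment (component 2 Ψ) {goalPosition s'}) :=
    (Reaches.par hcomp h₁ h₂).mono (Set.subset_iUnion (onTrack R) s')
  cases s with
  | some m =>
    exact reaches_onTrack hresources (.of_mem (hgoal.of_fork hΨ₂))
  | none =>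
    obtain h | ⟨m, h⟩ := hgoal.of_nil_branch hΨ₂
    · exact reaches_onTrack hresources (.of_mem h)
    · refine reaches_onTrack (s' := some m) (hresources.trans fun _ => reaches_resources)
        ⟨[replicative [], nonReplicative [false] (numeral 0),
          nonReplicative [true] (numeral 1)], ?_⟩
      rw [h]
      rfl

end Strategy

/-! ### Machines against strategies -/

section Computations

variable {A : ConstGame} {I : Set Position} {Φ : Position} {M : HPM} {e : Valuation}

open Classical in
/-- The moves by which the environment reaches the set `I` from the position `Φ`, if it can. -/
noncomputable def reply (I : Set Position) (Φ : Position) : List Move :=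
  if h : Reaches Player.environment Φ I then h.choose else []

theorem append_reply_mem (h : Reaches Player.environment Φ I) :
    Φ ++ moves Player.environment (reply I Φ) ∈ I := by
  rw [reply, dif_pos h]
  exact h.choose_spec

theorem passOrMove_moveMade (Φ : Position) (C : M.Config) :
    PassOrMove Player.machine Φ (Φ ++ C.moveMade) := by
  unfold HPM.Config.moveMade
  split_ifs
  · exact Or.inr ⟨_, rfl⟩
  · exact Or.inl (List.append_nil _)

/-- The configurations of `M` when the environment replies both before and after every step of the
machine. -/
noncomputable def configAgainst (M : HPM) (e : Valuation) (I : Set Position) : ℕ → M.Config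
  | 0 => M.init
  | k + 1 =>
    let C := configAgainst M e I k
    let Φ := C.position ++ moves Player.environment (reply I C.position) ++ (M.next e C).moveMade
    { M.next e C with position := Φ ++ moves Player.environment (reply I Φ) }

/-- The computation branch with the configurations `configAgainst M e I`. -/
noncomputable def branchAgainst (M : HPM) (e : Valuation) (I : Set Position) : M.Branch e where
  config := configAgainst M e I
  config_zero := rfl
  config_succ _ := ⟨_, _, rfl⟩

theorem position_mem_or_illegalBy (hI : I ⊆ A.legal)
    (hmaintains : Maintains A.legal Player.environment I) {k : ℕ}
    (hk : Reaches Player.environment ((branchAgainst M e I).config k).position I) :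
    ((branchAgainst M e I).config (k + 1)).position ∈ I ∨
      IllegalBy A.legal Player.machine (branchAgainst M e I).run := by
  let C := configAgainst M e I k
  let Φ := C.position ++ moves Player.environment (reply I C.position)
  have hΦ : Φ ∈ I := append_reply_mem hk
  have hmove := passOrMove_moveMade Φ (M.next e C)
  by_cases hlegal : Φ ++ (M.next e C).moveMade ∈ A.legal
  · exact Or.inl (append_reply_mem (hmaintains Φ hΦ _ hlegal hmove))
  · rcases hmove with h | ⟨α, h⟩
    · exact absurd (h.symm ▸ hI hΦ) hlegal
    · exact Or.inr ⟨Φ, α, h ▸ ⟨k + 1, List.prefix_append _ _⟩, hI hΦ, h ▸ hlegal⟩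

/-- A run follows the strategy `I` if it is a limit of positions in `I`. -/
def Follows (I : Set Position) (Γ : Run) : Prop :=
  ∀ Φ ∈ Γ.positions, ∃ Ψ ∈ Γ.positions, Φ <+: Ψ ∧ Ψ ∈ I

theorem exists_follows_or_illegalBy (M : HPM) (e : Valuation) (hI : I ⊆ A.legal)
    (hnil : Reaches Player.environment [] I)
    (hmaintains : Maintains A.legal Player.environment I) :
    ∃ B : M.Branch e, Follows I B.run ∨ IllegalBy A.legal Player.machine B.run := by
  refine ⟨branchAgainst M e I, or_iff_not_imp_right.2 fun hlegal => ?_⟩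
  have hstep {k} (hk : Reaches Player.environment ((branchAgainst M e I).config k).position I) :=
    (position_mem_or_illegalBy hI hmaintains hk).resolve_right hlegal
  have hreach (k) : Reaches Player.environment ((branchAgainst M e I).config k).position I := by
    induction k with
    | zero => exact hnil
    | succ k ih => exact .of_mem (hstep ih)
  rintro Φ ⟨k, hk⟩
  exact ⟨_, ⟨k + 1, List.prefix_rfl⟩,
    hk.trans ((branchAgainst M e I).position_prefix k.le_succ), hstep (hreach k)⟩

end Computations

/-! ### Winners -/

section Winners

variable {A B P : ConstGame} {r : Recurrence} {Γ : Run}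

theorem Player.ne_machine {p : Player} : p ≠ Player.machine ↔ p = Player.environment := by
  cases p <;> simp

theorem wn_eq_machine_iff {win : Run → Prop} (hA : A.Wn = winner A.legal win)
    (h : LegalRun A.legal Γ) : A.Wn Γ = Player.machine ↔ win Γ := by
  have hnot : ¬ IllegalBy A.legal Player.environment Γ := fun ⟨_, _, hmem, _, hΦ⟩ => hΦ (h hmem)
  by_cases hwin : win Γ <;> simp [hA, winner, h, hnot, hwin]

theorem neg_wn (h : LegalRun A.neg.legal Γ) :
    A.neg.Wn Γ = Player.machine ↔ ¬ A.Wn Γ.neg = Player.machine :=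
  (wn_eq_machine_iff rfl h).trans Player.ne_machine.symm

theorem pand_wn (h : LegalRun (A.pand B).legal Γ) :
    (A.pand B).Wn Γ = Player.machine ↔ A.Wn (Γ.filterMap (inComponent 1)) = Player.machine ∧
      B.Wn (Γ.filterMap (inComponent 2)) = Player.machine :=
  wn_eq_machine_iff rfl h

theorem por_wn (h : LegalRun (A.por B).legal Γ) :
    (A.por B).Wn Γ = Player.machine ↔ A.Wn (Γ.filterMap (inComponent 1)) = Player.machine ∨
      B.Wn (Γ.filterMap (inComponent 2)) = Player.machine :=
  wn_eq_machine_iff rfl h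

theorem branch_wn (h : LegalRun (A.branch r).legal Γ) :
    (A.branch r).Wn Γ = Player.machine ↔
      ∀ v, r.Relevant v → A.Wn (Γ.filterMap (inThread v)) = Player.machine :=
  wn_eq_machine_iff rfl h

theorem mem_neg_positions {Φ : Position} :
    Φ ∈ Γ.neg.positions ↔ ∃ Ψ ∈ Γ.positions, negate Ψ = Φ :=
  exists_congr fun Ψ => and_congr_right fun _ =>
    Eq.congr_left (congrFun (List.filterMap_eq_map' ..) Ψ)

theorem LegalRun.neg (h : LegalRun A.neg.legal Γ) : LegalRun A.legal Γ.neg := by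
  intro Φ hΦ
  obtain ⟨Ψ, hΨ, rfl⟩ := mem_neg_positions.1 hΦ
  exact h hΨ

theorem LegalRun.component_one (h : LegalRun (parLegal A B) Γ) :
    LegalRun A.legal (Γ.filterMap (inComponent 1)) := by
  rintro _ ⟨Φ, hΦ, rfl⟩
  exact (h hΦ).2.1

theorem LegalRun.component_two (h : LegalRun (parLegal A B) Γ) :
    LegalRun B.legal (Γ.filterMap (inComponent 2)) := by
  rintro _ ⟨Φ, hΦ, rfl⟩
  exact (h hΦ).2.2

theorem duplication_wn (h : LegalRun (duplication P).legal Γ) :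
    (duplication P).Wn Γ = Player.machine ↔
      (P.Wn (Γ.filterMap (inComponent 1)).neg = Player.machine →
        P.Wn ((Γ.filterMap (inComponent 2)).filterMap (inComponent 1)) = Player.machine ∧
        P.Wn ((Γ.filterMap (inComponent 2)).filterMap (inComponent 2)) = Player.machine) := by
  rw [duplication, por_wn h, neg_wn (h.component_one (A := P.neg)),
    pand_wn (h.component_two (B := P.pand P)), imp_iff_not_or]

theorem production_wn (h : LegalRun (production r P).legal Γ) :
    (production r P).Wn Γ = Player.machine ↔
      (P.Wn ((Γ.filterMap (inComponent 1)).neg.filterMap (inComponent 1)) = Player.machine →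
        (∀ v, r.Relevant v → (duplication P).Wn
          (((Γ.filterMap (inComponent 1)).neg.filterMap (inComponent 2)).filterMap (inThread v)) =
            Player.machine) →
        ∀ v, r.Relevant v →
          P.Wn ((Γ.filterMap (inComponent 2)).filterMap (inThread v)) = Player.machine) := by
  have hresources := h.component_one (A := (P.pand ((duplication P).branch r)).neg)
  rw [production, por_wn h, neg_wn hresources, pand_wn hresources.neg,
    branch_wn (hresources.neg.component_two (B := (duplication P).branch r)),
    branch_wn (h.component_two (B := P.branch r)), ← imp_iff_not_or, and_imp]

end Winners

section ChoiceGame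

variable {R : ℕ → ℕ → Prop} {Γ : Run}

theorem LegalRun.tail {p : Player} {A : ℕ → ConstGame} (h : LegalRun (choiceLegal p A) Γ) {c : ℕ}
    (hc : [(p, numeral c)] ∈ Γ.positions) : LegalRun (A c).legal Γ.tail := by
  rintro _ ⟨Ψ, hΨ, rfl⟩
  obtain rfl | ⟨c', Δ, rfl, hΔ⟩ := h hΨ
  · exact (A c).nil_legal
  · obtain rfl : c = c' := by
      rcases Γ.chain hc hΨ with h | h <;>
        simp_all [List.cons_prefix_cons, numeral_injective.eq_iff]
    exact hΔ

theorem mem_tail_positions {l : LabMove} {Φ : Position} (hl : [l] ∈ Γ.positions) (hΦ : Φ ≠ []) :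
    Φ ∈ Γ.tail.positions ↔ l :: Φ ∈ Γ.positions := by
  refine ⟨?_, fun h => ⟨_, h, rfl⟩⟩
  rintro ⟨_ | ⟨l', Ψ⟩, hΨ, rfl⟩
  · exact absurd rfl hΦ
  · obtain rfl : l = l' := by
      rcases Γ.chain hl hΨ with h | h <;> simp_all [List.cons_prefix_cons]
    exact hΨ

theorem choiceGame_wn (h : LegalRun (choiceGame R).legal Γ) :
    (choiceGame R).Wn Γ = Player.machine ↔
      ∃ c, chosen c none ∈ Γ.positions ∧ ∀ d, chosen c (some d) ∈ Γ.positions → R c d := by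
  refine (wn_eq_machine_iff rfl h).trans (exists_congr fun c => and_congr_right fun hc => ?_)
  have htail := h.tail hc
  refine (wn_eq_machine_iff rfl htail).trans (forall_congr' fun d => ?_)
  rw [mem_tail_positions hc (by simp)]
  refine imp_congr_right fun hd => ?_
  have hd' : [(Player.environment, numeral d)] ∈ Γ.tail.positions := ⟨_, hd, rfl⟩
  exact wn_eq_machine_iff rfl (htail.tail hd')

end ChoiceGame

/-! ### Runs that follow the strategies -/

section Follows

variable {A : ConstGame} {I J : Set Position} {Γ : Run}

theorem Follows.exists_mem (h : Follows I Γ) : ∃ Φ ∈ Γ.positions, Φ ∈ I :=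
  (h [] Γ.nil_mem).imp fun _ hΨ => ⟨hΨ.1, hΨ.2.2⟩

theorem Follows.legalRun (h : Follows I Γ) (hI : I ⊆ A.legal) : LegalRun A.legal Γ := fun Φ hΦ =>
  let ⟨_, _, hprefix, hΨ⟩ := h Φ hΦ
  A.prefix_legal hprefix (hI hΨ)

theorem Follows.filterMap (h : Follows I Γ) {f : LabMove → Option LabMove}
    (hf : ∀ Φ ∈ I, Φ.filterMap f ∈ J) : Follows J (Γ.filterMap f) := by
  rintro _ ⟨Φ, hΦ, rfl⟩
  obtain ⟨Ψ, hΨ, hprefix, hI⟩ := h Φ hΦ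
  exact ⟨_, ⟨Ψ, hΨ, rfl⟩, hprefix.filterMap f, hf Ψ hI⟩

theorem Follows.neg (h : Follows (negate ⁻¹' I) Γ) : Follows I Γ.neg := by
  intro Θ hΘ
  obtain ⟨Φ, hΦ, rfl⟩ := mem_neg_positions.1 hΘ
  obtain ⟨Ψ, hΨ, hprefix, hI⟩ := h Φ hΦ
  exact ⟨_, mem_neg_positions.2 ⟨Ψ, hΨ, rfl⟩, hprefix.map _, hI⟩

theorem Follows.component_one (h : Follows (parPositions I J) Γ) :
    Follows I (Γ.filterMap (inComponent 1)) :=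
  h.filterMap fun _ hΦ => hΦ.2.1

theorem Follows.component_two (h : Follows (parPositions I J) Γ) :
    Follows J (Γ.filterMap (inComponent 2)) :=
  h.filterMap fun _ hΦ => hΦ.2.2

theorem Follows.of_mem (h : Follows I Γ) {Φ₀ : Position} (hΦ₀ : Φ₀ ∈ Γ.positions)
    (hJ : ∀ Ψ ∈ I, Φ₀ <+: Ψ → Ψ ∈ J) : Follows J Γ := by
  intro Φ hΦ
  obtain ⟨Θ, hΘ, hΦΘ, hΦ₀Θ⟩ : ∃ Θ ∈ Γ.positions, Φ <+: Θ ∧ Φ₀ <+: Θ :=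
    (Γ.chain hΦ hΦ₀).elim (fun h => ⟨Φ₀, hΦ₀, h, List.prefix_rfl⟩)
      fun h => ⟨Φ, hΦ, List.prefix_rfl, h⟩
  obtain ⟨Ψ, hΨ, hprefix, hI⟩ := h Θ hΘ
  exact ⟨Ψ, hΨ, hΦΘ.trans hprefix, hJ Ψ hI (hΦ₀Θ.trans hprefix)⟩

end Follows

section Outcome

variable {R : ℕ → ℕ → Prop} {Q : ℕ → Prop} {S : Set ℕ} {a c d m : ℕ} {s : Option ℕ} {Γ : Run}

theorem chosen_none_mem_of_follows (h : Follows (Set.range (chosen c)) Γ) :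
    chosen c none ∈ Γ.positions := by
  obtain ⟨_, hmem, s, rfl⟩ := h.exists_mem
  exact Γ.prefix_mem (chosen_prefix_chosen.2 ⟨rfl, Or.inl rfl⟩) hmem

theorem follows_settledAt_of_mem (hΓ : Follows (Settled S) Γ)
    (ha : chosen a none ∈ (Γ.filterMap (inComponent 1)).neg.positions) :
    Follows (SettledAt S a) Γ := by
  obtain ⟨_, ⟨Φ, hΦ, rfl⟩, h⟩ := mem_neg_positions.1 ha
  refine hΓ.of_mem hΦ fun Ψ hΨ hprefix => ?_
  have hchosen : chosen a none <+: negate (component 1 Ψ) :=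
    h ▸ (hprefix.filterMap _).map LabMove.neg
  obtain hΨ | ⟨a', s₁, s₂, hΨ⟩ := hΨ <;> rw [Set.mem_singleton_iff.1 hΨ.2.1] at hchosen
  · simp [chosen] at hchosen
  · obtain ⟨rfl, -⟩ := chosen_prefix_chosen.1 hchosen
    exact ⟨s₁, s₂, hΨ⟩

theorem chosen_some_mem_of_left (hΓ : Follows (SettledAt S a) Γ) (hS : 2 * a + 1 ∈ S)
    (hd : chosen (2 * a + 1) (some d) ∈
      ((Γ.filterMap (inComponent 2)).filterMap (inComponent 1)).positions) :
    chosen a (some d) ∈ (Γ.filterMap (inComponent 1)).neg.positions := by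
  obtain ⟨_, ⟨Φ, hΦ, rfl⟩, hd⟩ := hd
  obtain ⟨Ψ, hΨ, hprefix, s₁, s₂, hparts⟩ := hΓ Φ hΦ
  have hchosen : chosen (2 * a + 1) (some d) <+: chosen (2 * a + 1) s₁ := by
    rw [← hparts.2.2.2.1, ← hd]
    exact (hprefix.filterMap _).filterMap _
  obtain rfl := (chosen_prefix_chosen.1 hchosen).2.resolve_left nofun
  exact mem_neg_positions.2
    ⟨_, ⟨Ψ, hΨ, rfl⟩, hparts.2.1.trans (by rw [answer, if_pos hS])⟩

theorem chosen_some_mem_of_right (hΓ : Follows (SettledAt S a) Γ) (hS₁ : 2 * a + 1 ∉ S)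
    (hS₂ : 2 * a + 2 ∈ S)
    (hd : chosen (2 * a + 2) (some d) ∈
      ((Γ.filterMap (inComponent 2)).filterMap (inComponent 2)).positions) :
    chosen a (some d) ∈ (Γ.filterMap (inComponent 1)).neg.positions := by
  obtain ⟨_, ⟨Φ, hΦ, rfl⟩, hd⟩ := hd
  obtain ⟨Ψ, hΨ, hprefix, s₁, s₂, hparts⟩ := hΓ Φ hΦ
  have hchosen : chosen (2 * a + 2) (some d) <+: chosen (2 * a + 2) s₂ := by
    rw [← hparts.2.2.2.2, ← hd]
    exact (hprefix.filterMap _).filterMap _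
  obtain rfl := (chosen_prefix_chosen.1 hchosen).2.resolve_left nofun
  exact mem_neg_positions.2
    ⟨_, ⟨Ψ, hΨ, rfl⟩, hparts.2.1.trans (by rw [answer, if_neg hS₁, if_pos hS₂])⟩

theorem duplication_wn_of_follows (hΓ : Follows (Settled S) Γ) (hS : IsPath S) :
    (duplication (choiceGame fun c y => c ∈ S → Q y)).Wn Γ = Player.machine := by
  have hlegal := hΓ.legalRun (settled_subset_legal (R := fun c y => c ∈ S → Q y))
  have hlegal₂ := hlegal.component_two (B := (choiceGame _).pand (choiceGame _))
  rw [duplication_wn hlegal, choiceGame_wn (hlegal.component_one (A := (choiceGame _).neg)).neg,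
    choiceGame_wn hlegal₂.component_one, choiceGame_wn hlegal₂.component_two]
  rintro ⟨a, ha, hQ⟩
  have hΓa := follows_settledAt_of_mem hΓ ha
  have hchildren : Follows (parPositions (Set.range (chosen (2 * a + 1)))
      (Set.range (chosen (2 * a + 2)))) (Γ.filterMap (inComponent 2)) :=
    hΓa.filterMap fun _ ⟨s₁, s₂, hΦ⟩ =>
      ⟨hΦ.2.2.1, ⟨s₁, hΦ.2.2.2.1.symm⟩, ⟨s₂, hΦ.2.2.2.2.symm⟩⟩
  refine ⟨⟨2 * a + 1, chosen_none_mem_of_follows hchildren.component_one, fun d hd h₁ => ?_⟩,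
    ⟨2 * a + 2, chosen_none_mem_of_follows hchildren.component_two, fun d hd h₂ => ?_⟩⟩
  · exact hQ d (chosen_some_mem_of_left hΓa h₁ hd) (hS.parent_mem (Or.inl h₁))
  · exact hQ d (chosen_some_mem_of_right hΓa (fun h₁ => hS.not_both h₁ h₂) h₂ hd)
      (hS.parent_mem (Or.inr h₂))

theorem eq_of_fork_prefix_goalPosition (h : fork m <+: goalPosition s) :
    s = some m := by
  cases s with
  | none => simp [goalPosition, fork] at h
  | some m' =>
    have hthread : thread (fun _ => false) (fork m) <+: thread (fun _ => false) (fork m') :=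
      h.filterMap _
    rw [thread_fork, thread_fork] at hthread
    rw [(chosen_prefix_chosen.1 hthread).1]

theorem exists_follows_onTrack (h : Follows (⋃ s, onTrack R s) Γ) :
    ∃ s, Follows (onTrack R s) Γ := by
  by_cases hgoal : ∃ m, ∃ Φ ∈ Γ.positions, Φ ∈ onTrack R (some m)
  · obtain ⟨m, Φ, hΦ, hm⟩ := hgoal
    refine ⟨some m, h.of_mem hΦ fun Ψ hΨ hprefix => ?_⟩
    obtain ⟨s, hs⟩ := Set.mem_iUnion.1 hΨ
    have hfork : component 2 Φ <+: component 2 Ψ := hprefix.filterMap _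
    rw [show component 2 Φ = fork m from hm.2.2, show component 2 Ψ = _ from hs.2.2] at hfork
    exact eq_of_fork_prefix_goalPosition hfork ▸ hs
  · refine ⟨none, fun Φ hΦ => ?_⟩
    obtain ⟨Ψ, hΨ, hprefix, hs⟩ := h Φ hΦ
    obtain ⟨_ | m, hs⟩ := Set.mem_iUnion.1 hs
    · exact ⟨Ψ, hΨ, hprefix, hs⟩
    · exact absurd ⟨m, Ψ, hΨ, hs⟩ hgoal

theorem of_choiceGame_wn_goal {v : ℕ → Bool}
    (hΓ : Follows {goalPosition s} Γ)
    (h : (choiceGame fun c y => c ∈ path s → Q y).Wn (Γ.filterMap (inThread v)) =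
      Player.machine) : Q (if v 0 then 1 else 0) := by
  have hthread : Follows {thread v (goalPosition s)} (Γ.filterMap (inThread v)) :=
    hΓ.filterMap fun Φ hΦ => congrArg _ hΦ
  rw [choiceGame_wn (hthread.legalRun (Set.singleton_subset_iff.2
    (thread_mem_legal (goalPosition_mem_branchLegal s) v)))] at h
  obtain ⟨c, hc, hQ⟩ := h
  obtain ⟨_, -, hprefix, rfl⟩ := hthread _ hc
  cases s with
  | none => simp [goalPosition, thread, sift, chosen] at hprefix
  | some m =>
    obtain ⟨_, hmem, rfl⟩ := hthread.exists_mem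
    rw [show thread v (goalPosition (some m)) = _ from thread_fork v m] at hprefix hmem
    obtain ⟨rfl, -⟩ := chosen_prefix_chosen.1 hprefix
    exact hQ _ hmem ⟨0, rfl⟩

theorem Recurrence.relevant_appendBits_false (r : Recurrence) (w : List Bool) :
    r.Relevant (appendBits w fun _ => false) := by
  cases r with
  | uncountable => trivial
  | countable =>
    refine (Set.finite_lt_nat w.length).subset fun n hn => ?_
    by_contra hlt
    simp_all [appendBits]

theorem exists_production_wn_ne {R₀ : ℕ → ℕ → Prop} (hΓ : Follows (⋃ s, onTrack R₀ s) Γ)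
    (r : Recurrence) : ∃ R, (production r (choiceGame R)).Wn Γ ≠ Player.machine := by
  obtain ⟨s, hs⟩ := exists_follows_onTrack hΓ
  let γ : Run := (Γ.filterMap (inComponent 1)).neg.filterMap (inComponent 1)
  let Q (y : ℕ) : Prop := chosen 0 (some y) ∈ γ.positions
  let R (c y : ℕ) : Prop := c ∈ path s → Q y
  refine ⟨R, fun hwn => ?_⟩
  have hfollows : Follows (onTrack R s) Γ := onTrack_congr R₀ R ▸ hs
  have hlegal := hfollows.legalRun (onTrack_subset_legal r s)
  have hresources := hfollows.component_one.neg
  have hP : (choiceGame R).Wn γ = Player.machine := (choiceGame_wn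
    (hresources.component_one.legalRun (by rintro _ ⟨s, rfl⟩; exact chosen_mem_legal 0 s))).2
    ⟨0, chosen_none_mem_of_follows hresources.component_one, fun _ hd _ => hd⟩
  have hduplication (v : ℕ → Bool) := duplication_wn_of_follows (Q := Q)
    (hresources.component_two.filterMap fun Φ hΦ => hΦ.2 v) (isPath_path s)
  have hQ (b : Bool) : Q (if b then 1 else 0) := of_choiceGame_wn_goal hfollows.component_two <|
    (production_wn hlegal).1 hwn hP (fun v _ => hduplication v)
      (appendBits [b] fun _ => false) (r.relevant_appendBits_false [b])
  rcases γ.chain (hQ false) (hQ true) with h | h <;> simp [chosen_prefix_chosen] at h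

theorem exists_wn_ne_machine (M : HPM) (e : Valuation) (r : Recurrence) :
    ∃ (R : ℕ → ℕ → Prop) (B : M.Branch e),
      (production r (choiceGame R)).Wn B.run ≠ Player.machine := by
  obtain ⟨B, hfollows | hillegal⟩ := exists_follows_or_illegalBy M e
    (Set.iUnion_subset (onTrack_subset_legal (R := fun _ _ => True) r))
    (reaches_onTrack_nil _) (maintains_onTrack r)
  · obtain ⟨R, hR⟩ := exists_production_wn_ne hfollows r
    exact ⟨R, B, hR⟩
  · exact ⟨_, B, Player.ne_machine.2 ((production r _).wn_illegal _ _ hillegal)⟩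

end Outcome

/-! ### Interpretations -/

section Interpretations

variable (R : ℕ → ℕ → Prop) (r : Recurrence) (p : ℕ) {x y : Var}

/-- The interpretation that sends every letter to the predicate `R` of the variables `0` and `1`,
the first two variables of the attached tuple of a binary letter. -/
def binaryInterpretation : Interpretation where
  tuple _ _ j := j.val
  tuple_injective _ _ := Fin.val_injective
  holds _ _ e := R (e 0) (e 1)

theorem choiceFormula_toGame (hxy : x ≠ y) (e : Valuation) :
    (choiceFormula p x y).toGame (binaryInterpretation R) e = choiceGame R := by
  have hextend (f : Fin 2 → ℕ) (e' : Valuation) (j : Fin 2) :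
      Function.extend (fun j : Fin 2 => j.val) f e' j.val = f j :=
    Fin.val_injective.extend_apply f e' j
  have hzero := fun f e' => hextend f e' 0
  have hone := fun f e' => hextend f e' 1
  simp only [Fin.val_zero, Fin.val_one] at hzero hone
  simp [choiceFormula, Formula.toGame, binaryInterpretation, choiceGame, hzero, hone, Term.eval,
    Function.update_of_ne hxy]

theorem binaryInterpretation_admissible (x y : Var) :
    (binaryInterpretation R).Admissible (shortProduction r (choiceFormula p x y)) := by
  rintro n i hletter z - hz ⟨e, e', heq, hne⟩
  have hbinary : (n, i) = (2, p) := by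
    simpa [shortProduction, choiceFormula, Formula.imp, Formula.letters] using hletter
  obtain ⟨rfl, rfl⟩ := Prod.mk.inj hbinary
  refine hne ?_
  simp only [binaryInterpretation, heq 0 fun h => hz ⟨0, h⟩, heq 1 fun h => hz ⟨1, h⟩]

theorem not_uniformlyValid_shortProduction (hxy : x ≠ y) :
    ¬ UniformlyValid (shortProduction r (choiceFormula p x y)) := by
  rintro ⟨M, hM⟩
  obtain ⟨R, B, hB⟩ := exists_wn_ne_machine M (fun _ => 0) r
  refine hB ?_
  have hwn := hM (binaryInterpretation R) (binaryInterpretation_admissible R r p x y) _ B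
  simpa only [shortProduction, Formula.imp, Formula.toGame, choiceFormula_toGame R p hxy,
    production, duplication] using hwn

end Interpretations

end CoL

theorem mainTheorem3 (p : ℕ) (x y : CoL.Var) (hxy : x ≠ y) :
    ¬ CoL.UniformlyValid
        (CoL.shortProduction CoL.Recurrence.uncountable (CoL.choiceFormula p x y)) ∧
    ¬ CoL.UniformlyValid
        (CoL.shortProduction CoL.Recurrence.countable (CoL.choiceFormula p x y)) :=
  ⟨CoL.not_uniformlyValid_shortProduction _ p hxy, CoL.not_uniformlyValid_shortProduction _ p hxy⟩
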